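/- An instance of Directed Steiner Network consists of a finite digraph $G=(V,E)$, a set of terminal pairs $T=\{(s_1,t_1),\dots,(s_k,t_k)\}\subseteq V\times V$, and a demand $d_i\in\mathbb{N}$ for each $i\in[k]$. A (feasible) solution is a set $E'\subseteq E$ such that for every $i\in[k]$ the digraph $(V,E')$ contains $d_i$ pairwise edge-disjoint directed $s_i\to t_i$ paths; $OPT$ denotes the minimum cardinality $|E'|$ of a solution, if a solution exists. (If $s_i=t_i$, the demand is satisfied by trivial paths without edges.) Directed Steiner Network admits an $OPT^2$-approximation in polynomial time. That is, there is an algorithm which halts on every instance after a number of steps polynomial in the input size $|V|+|E|+\sum_{i}(1+\ell(d_i))$, where $\ell(d_i)$ is the number of binary digits of $d_i$, and which, on every instance that has a solution, outputs a solution $E'$ with $|E'|\le OPT^2\cdot OPT$. Moreover, the output is of the form $E'=\bigcup_{i=1}^k E_i$, where $E_i\subseteq E$ is an edge set of minimum cardinality such that $(V,E_i)$ contains $d_i$ pairwise edge-disjoint directed $s_i\to t_i$ paths. Here algorithms are programs for a random access machine over $\mathbb{N}$ with addition and truncated subtraction, where each elementary operation costs one step. -/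

import Mathlib

/-! ## Machine model

A structured random access machine over the natural numbers. The memory consists of banks; a bank is
an infinite array of natural numbers indexed by natural numbers, and a program mentions only finitely
many banks. The arithmetic operations are addition and truncated subtraction (no multiplication),
and every constant, memory access, arithmetic operation, assignment and test costs one step. This is
the additive RAM with uniform cost, which is polynomially equivalent to Turing machines. -/

namespace RAM

/-- `mem b i` is the content of cell `i` of bank `b`. -/
abbrev Mem : Type := ℕ → ℕ → ℕ

/-- Arithmetic expressions. -/
inductive Expr : Type
  | const (c : ℕ) : Expr
  | read (b : ℕ) (i : Expr) : Expr
  | add (e₁ e₂ : Expr) : Expr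
  | sub (e₁ e₂ : Expr) : Expr

/-- The value of an expression. -/
def Expr.eval (σ : Mem) : Expr → ℕ
  | .const c => c
  | .read b i => σ b (i.eval σ)
  | .add e₁ e₂ => e₁.eval σ + e₂.eval σ
  | .sub e₁ e₂ => e₁.eval σ - e₂.eval σ

/-- The number of steps needed to evaluate an expression. -/
def Expr.cost : Expr → ℕ
  | .const _ => 1
  | .read _ i => i.cost + 1
  | .add e₁ e₂ => e₁.cost + e₂.cost + 1
  | .sub e₁ e₂ => e₁.cost + e₂.cost + 1

/-- Programs. The conditional and the loop test whether an expression is nonzero. -/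
inductive Prog : Type
  | skip : Prog
  | write (b : ℕ) (i e : Expr) : Prog
  | seq (p q : Prog) : Prog
  | ite (e : Expr) (p q : Prog) : Prog
  | loop (e : Expr) (p : Prog) : Prog

/-- The memory after storing `v` in cell `i` of bank `b`. -/
def Mem.set (σ : Mem) (b i v : ℕ) : Mem :=
  fun b' i' => if b' = b ∧ i' = i then v else σ b' i'

/-- `Runs p σ σ' t`: started in memory `σ`, the program `p` halts in memory `σ'` after exactly
`t` steps. -/
inductive Runs : Prog → Mem → Mem → ℕ → Prop
  | skip (σ : Mem) : Runs .skip σ σ 1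
  | write (σ : Mem) (b : ℕ) (i e : Expr) :
      Runs (.write b i e) σ (σ.set b (i.eval σ) (e.eval σ)) (i.cost + e.cost + 1)
  | seq {p q : Prog} {σ₁ σ₂ σ₃ : Mem} {s t : ℕ} (hp : Runs p σ₁ σ₂ s) (hq : Runs q σ₂ σ₃ t) :
      Runs (.seq p q) σ₁ σ₃ (s + t)
  | ite_true {e : Expr} {p : Prog} (q : Prog) {σ σ' : Mem} {t : ℕ} (he : e.eval σ ≠ 0)
      (hp : Runs p σ σ' t) : Runs (.ite e p q) σ σ' (e.cost + 1 + t)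
  | ite_false {e : Expr} (p : Prog) {q : Prog} {σ σ' : Mem} {t : ℕ} (he : e.eval σ = 0)
      (hq : Runs q σ σ' t) : Runs (.ite e p q) σ σ' (e.cost + 1 + t)
  | loop_done {e : Expr} (p : Prog) {σ : Mem} (he : e.eval σ = 0) :
      Runs (.loop e p) σ σ (e.cost + 1)
  | loop_step {e : Expr} {p : Prog} {σ₁ σ₂ σ₃ : Mem} {s t : ℕ} (he : e.eval σ₁ ≠ 0)
      (hp : Runs p σ₁ σ₂ s) (hl : Runs (.loop e p) σ₂ σ₃ t) :
      Runs (.loop e p) σ₁ σ₃ (e.cost + 1 + s + t)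

/-- The initial memory: the input is written in bank `0`, all other cells are `0`. -/
def inputMem (x : List ℕ) : Mem :=
  fun b i => if b = 0 then x.getD i 0 else 0

/-- Bank `1` of the memory `σ` holds the output `y`: its length in cell `0`, followed by its
entries. -/
def HoldsOutput (σ : Mem) (y : List ℕ) : Prop :=
  σ 1 0 = y.length ∧ ∀ i < y.length, σ 1 (i + 1) = y.getD i 0

/-- On input `x`, the program `p` halts after exactly `t` steps with output `y`. -/
def Outputs (p : Prog) (x y : List ℕ) (t : ℕ) : Prop :=
  ∃ σ : Mem, Runs p (inputMem x) σ t ∧ HoldsOutput σ y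

end RAM

/-! ## Directed Steiner Network -/

section DirectedPaths

variable {V : Type*}

/-- The edges traversed by a path, given as the list of its vertices. -/
def pathEdges (p : List V) : List (V × V) := p.zip p.tail

/-- `p` is the vertex list of a (simple) directed path from `s` to `t` with edges in `F`. -/
def IsDirectedPath (F : Finset (V × V)) (s t : V) (p : List V) : Prop :=
  p.head? = some s ∧ p.getLast? = some t ∧ p.Nodup ∧ ∀ e ∈ pathEdges p, e ∈ F

/-- The digraph with edge set `F` has `d` pairwise edge-disjoint directed paths from `s` to `t`. -/
def HasDisjointPaths (F : Finset (V × V)) (s t : V) (d : ℕ) : Prop :=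
  ∃ P : Fin d → List V, (∀ j, IsDirectedPath F s t (P j)) ∧
    ∀ j j', j ≠ j' → (pathEdges (P j)).Disjoint (pathEdges (P j'))

end DirectedPaths

/-- An instance of Directed Steiner Network: a digraph with vertex set `{0, …, n - 1}`, given by the
list of its edges, and a list of entries `((sᵢ, tᵢ), dᵢ)`, where the terminal pairs `(sᵢ, tᵢ)` are
distinct and `dᵢ` is the demand of the pair. -/
structure DSNInstance where
  n : ℕ
  edges : List (Fin n × Fin n)
  demands : List ((Fin n × Fin n) × ℕ)
  edges_nodup : edges.Nodup
  terminals_nodup : (demands.map Prod.fst).Nodup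

namespace DSNInstance

/-- The list of endpoints `u₁, v₁, u₂, v₂, …` that describes a list of edges. -/
def encodeEdges {n : ℕ} (L : List (Fin n × Fin n)) : List ℕ :=
  L.flatMap fun e => [(e.1 : ℕ), (e.2 : ℕ)]

/-- The input given to an algorithm: the number of vertices, the number of edges, the edges, the
number of terminal pairs, and `sᵢ, tᵢ, dᵢ` for each terminal pair. -/
def encode (I : DSNInstance) : List ℕ :=
  [I.n, I.edges.length] ++ encodeEdges I.edges ++ [I.demands.length] ++
    I.demands.flatMap fun q => [(q.1.1 : ℕ), (q.1.2 : ℕ), q.2]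

/-- The input size: number of vertices plus number of edges plus, for each terminal pair, one plus
the number of binary digits of its demand. -/
def size (I : DSNInstance) : ℕ :=
  I.n + I.edges.length + (I.demands.map fun q => 1 + Nat.size q.2).sum

/-- `F` is a set of edges of the digraph that carries the demanded number of disjoint paths for
every terminal pair. -/
def IsSolution (I : DSNInstance) (F : Finset (Fin I.n × Fin I.n)) : Prop :=
  F ⊆ I.edges.toFinset ∧ ∀ q ∈ I.demands, HasDisjointPaths F q.1.1 q.1.2 q.2

/-- The minimum number of edges in a solution (meaningful if there is a solution). -/
noncomputable def opt (I : DSNInstance) : ℕ :=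
  sInf {c | ∃ F, I.IsSolution F ∧ F.card = c}

/-- `F` is a minimum-cardinality set of edges of the digraph that contains `d` pairwise disjoint
directed paths from `s` to `t`. -/
def IsMinEdgeSet (I : DSNInstance) (s t : Fin I.n) (d : ℕ) (F : Finset (Fin I.n × Fin I.n)) :
    Prop :=
  F ⊆ I.edges.toFinset ∧ HasDisjointPaths F s t d ∧
    ∀ F' ⊆ I.edges.toFinset, HasDisjointPaths F' s t d → F.card ≤ F'.card

end DSNInstance

/-! Let `F` be an optimal solution. A minimum edge set for one pair has at most `|F|` edges, since
`F` itself carries that pair's demand. It is empty if `s = t` or `d = 0`; otherwise `F` contains a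
path from `s` to `t`, so `s` is the tail and `t` the head of edges of `F`. As the terminal pairs are
distinct, at most `OPT ^ 2` of them contribute, and any union of minimum edge sets has at most `OPT
^ 3` edges (`DSNInstance.card_biUnion_le`).

It remains to compute a minimum edge set for one pair, which is a minimum-cost flow problem with
unit capacities and unit costs. `HasDisjointPaths.exists_isFlow` and `IsFlow.hasDisjointPaths` pass
between paths and flows. The program is a primal-dual method. It keeps a flow and a potential `π` in
complementary slackness, with `π s = 0`, and searches from `s` along tight residual edges. If `t` is
found, it augments (`wp_augment`); otherwise it raises `π` by one on all vertices not found
(`wp_raise`). Slackness makes the flow cheapest for its value (`IsSlack.card_le`).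

Every phase with unmet demand increases `k + π t` by one, where `k` is the value of the flow
(`wp_phase`). If `s ≠ t` and the demand is feasible but unmet, then `k` and `π t` are both at most
`m`, the number of edges. Hence `2 * m + 1` phases suffice (`IsSlack.min_of_le`), however large the
demand is, and the running time is polynomial. -/

section Flows

variable {V : Type*}

/-! ### Edge-disjoint paths and unit-capacity flows. -/

@[simp] theorem pathEdges_cons_cons (a b : V) (l : List V) :
    pathEdges (a :: b :: l) = (a, b) :: pathEdges (b :: l) := rfl

theorem fst_mem_of_mem_pathEdges {p : List V} {e : V × V} (h : e ∈ pathEdges p) : e.1 ∈ p :=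
  (List.of_mem_zip (a := e.1) (b := e.2) h).1

theorem pathEdges_subset_append (l q : List V) : pathEdges q ⊆ pathEdges (l ++ q) := by
  induction l with
  | nil => simp
  | cons a l ih =>
    cases h : l ++ q with
    | nil =>
      obtain ⟨-, rfl⟩ := List.append_eq_nil_iff.1 h
      simp [pathEdges]
    | cons b r =>
      rw [List.cons_append, h, pathEdges_cons_cons, ← h]
      exact fun e he => List.mem_cons_of_mem _ (ih he)

theorem HasDisjointPaths.mono {F F' : Finset (V × V)} {s t : V} {d : ℕ} (hF : F ⊆ F')
    (h : HasDisjointPaths F s t d) : HasDisjointPaths F' s t d := by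
  obtain ⟨P, hP, hd⟩ := h
  exact ⟨P, fun j => ⟨(hP j).1, (hP j).2.1, (hP j).2.2.1, fun e he => hF ((hP j).2.2.2 e he)⟩, hd⟩

theorem hasDisjointPaths_self (F : Finset (V × V)) (s : V) (d : ℕ) :
    HasDisjointPaths F s s d :=
  ⟨fun _ => [s], fun _ => ⟨rfl, rfl, by simp, by simp [pathEdges]⟩, by simp [pathEdges]⟩

theorem hasDisjointPaths_zero (F : Finset (V × V)) (s t : V) : HasDisjointPaths F s t 0 :=
  ⟨fun j => j.elim0, fun j => j.elim0, fun j => j.elim0⟩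

variable [DecidableEq V]

/-- The net number of edges of `F` that leave the vertex `x`. -/
def netOut (F : Finset (V × V)) (x : V) : ℤ :=
  ∑ e ∈ F, ((if e.1 = x then 1 else 0) - (if e.2 = x then 1 else 0))

/-- `F` is a unit-capacity flow of value `k` from `s` to `t`. -/
def IsFlow (F : Finset (V × V)) (s t : V) (k : ℕ) : Prop :=
  ∀ x, netOut F x = (if x = s then (k : ℤ) else 0) - (if x = t then (k : ℤ) else 0)

/-- The potential `π` certifies that `F` uses exactly the profitable edges of `E`. -/
def IsSlack (E F : Finset (V × V)) (π : V → ℕ) : Prop :=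
  ∀ e ∈ E, (e ∈ F → π e.1 + 1 ≤ π e.2) ∧ (e ∉ F → π e.2 ≤ π e.1 + 1)

theorem netOut_insert {F : Finset (V × V)} {e : V × V} (he : e ∉ F) (x : V) :
    netOut (insert e F) x =
      ((if e.1 = x then 1 else 0) - (if e.2 = x then 1 else 0)) + netOut F x := by
  simp only [netOut, Finset.sum_insert he]

theorem netOut_erase {F : Finset (V × V)} {e : V × V} (he : e ∈ F) (x : V) :
    netOut (F.erase e) x =
      netOut F x - ((if e.1 = x then 1 else 0) - (if e.2 = x then 1 else 0)) := by
  have := netOut_insert (Finset.notMem_erase e F) x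
  rw [Finset.insert_erase he] at this
  omega

theorem netOut_sdiff {F G : Finset (V × V)} (h : G ⊆ F) (x : V) :
    netOut (F \ G) x = netOut F x - netOut G x := by
  have := Finset.sum_sdiff (f := fun e : V × V =>
    ((if e.1 = x then 1 else 0) - (if e.2 = x then 1 else 0) : ℤ)) h
  simp only [netOut]
  omega

theorem netOut_le_card (F : Finset (V × V)) (x : V) : netOut F x ≤ F.card := by
  have : netOut F x ≤ ∑ _e ∈ F, (1 : ℤ) := by
    refine Finset.sum_le_sum fun e _ => ?_
    split_ifs <;> omega
  simpa using this

theorem isFlow_empty (s t : V) : IsFlow (∅ : Finset (V × V)) s t 0 := by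
  intro x; simp [netOut]

/-- For equal terminals the two terms of the balance condition cancel, so the value carries no
information. -/
theorem IsFlow.of_eq {F : Finset (V × V)} {s : V} {k : ℕ} (h : IsFlow F s s k) (k' : ℕ) :
    IsFlow F s s k' := by
  intro x; simpa using h x

theorem isFlow_pathEdges {p : List V} {s t : V} (hs : p.head? = some s)
    (ht : p.getLast? = some t) (hp : p.Nodup) : IsFlow (pathEdges p).toFinset s t 1 := by
  induction p generalizing s with
  | nil => simp at hs
  | cons a l ih =>
    obtain rfl : a = s := by simpa using hs
    cases l with
    | nil =>
      obtain rfl : a = t := by simpa using ht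
      intro x
      simp [pathEdges, netOut]
    | cons b l =>
      intro x
      -- The path is simple, so its first vertex is not the tail of a later edge, and the first edge
      -- is counted only once.
      have hab : (a, b) ∉ (pathEdges (b :: l)).toFinset := by
        intro h
        exact (List.nodup_cons.1 hp).1 (fst_mem_of_mem_pathEdges (List.mem_toFinset.1 h))
      have := ih (s := b) rfl (by simpa using ht) (List.nodup_cons.1 hp).2 x
      rw [pathEdges_cons_cons, List.toFinset_cons, netOut_insert hab, this]
      simp only [eq_comm (a := x)]
      push_cast
      ring

theorem HasDisjointPaths.exists_isFlow {F : Finset (V × V)} {s t : V} {d : ℕ}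
    (h : HasDisjointPaths F s t d) : ∃ F₀ ⊆ F, IsFlow F₀ s t d := by
  obtain ⟨P, hP, hd⟩ := h
  refine ⟨Finset.univ.biUnion fun j => (pathEdges (P j)).toFinset, ?_, ?_⟩
  · intro e he
    obtain ⟨j, -, hj⟩ := Finset.mem_biUnion.1 he
    exact (hP j).2.2.2 e (List.mem_toFinset.1 hj)
  · intro x
    have hdis : ((Finset.univ : Finset (Fin d)) : Set (Fin d)).PairwiseDisjoint
        fun j => (pathEdges (P j)).toFinset := by
      intro i _ j _ hij
      simp only [Function.onFun]
      rw [Finset.disjoint_left]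
      intro e hi hj
      exact hd i j hij (List.mem_toFinset.1 hi) (List.mem_toFinset.1 hj)
    have : netOut (Finset.univ.biUnion fun j => (pathEdges (P j)).toFinset) x =
        ∑ j, netOut (pathEdges (P j)).toFinset x := Finset.sum_biUnion hdis
    rw [this, Finset.sum_congr rfl fun j _ =>
      isFlow_pathEdges (hP j).1 (hP j).2.1 (hP j).2.2.1 x]
    simp

theorem exists_isDirectedPath_of_reflTransGen {F : Finset (V × V)} {s t : V}
    (h : Relation.ReflTransGen (fun a b => (a, b) ∈ F) s t) : ∃ p, IsDirectedPath F s t p := by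
  induction h using Relation.ReflTransGen.head_induction_on with
  | refl => exact ⟨[t], rfl, rfl, by simp, by simp [pathEdges]⟩
  | @head a b hab _ ih =>
    obtain ⟨p, hb, ht, hn, hF⟩ := ih
    -- To keep the path simple, a path that already visits `a` is cut so that it starts there.
    by_cases ha : a ∈ p
    · obtain ⟨l₁, l₂, rfl⟩ := List.append_of_mem ha
      refine ⟨a :: l₂, rfl, ?_, (List.nodup_append.1 hn).2.1,
        fun e he => hF e (pathEdges_subset_append _ _ he)⟩
      rw [← ht, List.getLast?_append_of_ne_nil _ (by simp)]
    · cases p with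
      | nil => simp at hb
      | cons c l =>
        obtain rfl : c = b := by simpa using hb
        refine ⟨a :: c :: l, rfl, by simpa using ht, List.nodup_cons.2 ⟨ha, hn⟩, ?_⟩
        intro e he
        rw [pathEdges_cons_cons, List.mem_cons] at he
        rcases he with rfl | he
        · exact hab
        · exact hF e he

variable [Fintype V]

theorem sum_mul_netOut (F : Finset (V × V)) (f : V → ℤ) :
    ∑ x, f x * netOut F x = ∑ e ∈ F, (f e.1 - f e.2) := by
  simp only [netOut, Finset.mul_sum]
  rw [Finset.sum_comm]
  refine Finset.sum_congr rfl fun e _ => ?_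
  simp [mul_sub]

/-- Summation by parts: the total drop of a function along a flow depends only on its value and its
terminals. It yields both the cut argument and weak duality. -/
theorem IsFlow.sum_sub {F : Finset (V × V)} {s t : V} {k : ℕ} (h : IsFlow F s t k) (f : V → ℤ) :
    ∑ e ∈ F, (f e.1 - f e.2) = k * (f s - f t) := by
  rw [← sum_mul_netOut, Finset.sum_congr rfl fun x _ => by rw [h x]]
  simp [mul_sub]
  ring

/-- Otherwise take the indicator of the set reachable from `s`. No edge of `F` leaves this set, so
its total drop along `F` is at most `0`, whereas the flow condition makes it `k + 1`. -/
theorem IsFlow.reflTransGen {F : Finset (V × V)} {s t : V} {k : ℕ} (h : IsFlow F s t (k + 1)) :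
    Relation.ReflTransGen (fun a b => (a, b) ∈ F) s t := by
  classical
  by_contra hst
  have hsum := h.sum_sub fun x =>
    if Relation.ReflTransGen (fun a b => (a, b) ∈ F) s x then (1 : ℤ) else 0
  rw [if_pos Relation.ReflTransGen.refl, if_neg hst] at hsum
  have hle : ∑ e ∈ F, ((if Relation.ReflTransGen (fun a b => (a, b) ∈ F) s e.1 then (1 : ℤ) else 0)
      - (if Relation.ReflTransGen (fun a b => (a, b) ∈ F) s e.2 then (1 : ℤ) else 0)) ≤ 0 := by
    refine Finset.sum_nonpos fun e he => ?_
    by_cases h1 : Relation.ReflTransGen (fun a b => (a, b) ∈ F) s e.1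
    · rw [if_pos h1, if_pos (h1.tail he)]; simp
    · rw [if_neg h1]; split_ifs <;> simp
  push_cast at hsum
  omega

/-- Removing the edges of one simple path lowers the value by one. Cycles may be left over at the
end; they do no harm. -/
theorem IsFlow.hasDisjointPaths {F : Finset (V × V)} {s t : V} {k : ℕ} (h : IsFlow F s t k) :
    HasDisjointPaths F s t k := by
  induction k generalizing F with
  | zero => exact hasDisjointPaths_zero F s t
  | succ k ih =>
    obtain ⟨p, hp⟩ := exists_isDirectedPath_of_reflTransGen h.reflTransGen
    have hsub : (pathEdges p).toFinset ⊆ F := fun e he => hp.2.2.2 e (List.mem_toFinset.1 he)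
    have hflow : IsFlow (F \ (pathEdges p).toFinset) s t k := by
      intro x
      rw [netOut_sdiff hsub, h x, isFlow_pathEdges hp.1 hp.2.1 hp.2.2.1 x]
      push_cast
      split_ifs <;> ring
    obtain ⟨P, hP, hd⟩ := ih hflow
    have hpP : ∀ j, (pathEdges p).Disjoint (pathEdges (P j)) := fun j e he hj =>
      (Finset.mem_sdiff.1 ((hP j).2.2.2 e hj)).2 (List.mem_toFinset.2 he)
    refine ⟨Fin.cons p P, ?_, ?_⟩
    · intro j
      refine Fin.cases ?_ (fun j => ?_) j
      · simpa using hp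
      · simp only [Fin.cons_succ]
        exact ⟨(hP j).1, (hP j).2.1, (hP j).2.2.1,
          fun e he => Finset.sdiff_subset ((hP j).2.2.2 e he)⟩
    · intro i j
      refine Fin.cases ?_ (fun i => ?_) i <;> refine Fin.cases ?_ (fun j => ?_) j
      · simp
      · intro _; simpa using hpP j
      · intro _; simpa using (hpP i).symm
      · intro hij
        simpa using hd i j fun h => hij (by rw [h])

/-! ### Optimality of flows certified by potentials. -/

/-- Weak duality for unit-capacity flows with unit costs. -/
theorem IsSlack.card_le {E F F' : Finset (V × V)} {π : V → ℕ} (hπ : IsSlack E F π) (hF : F ⊆ E)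
    (hF' : F' ⊆ E) {s t : V} {k d : ℕ} (h : IsFlow F s t k) (h' : IsFlow F' s t d) :
    (F.card : ℤ) + k * ((π s : ℤ) - π t) ≤ F'.card + d * ((π s : ℤ) - π t) := by
  have key : ∀ (G : Finset (V × V)) (l : ℕ), IsFlow G s t l →
      ∑ e ∈ G, (1 + ((π e.1 : ℤ) - π e.2)) = G.card + l * ((π s : ℤ) - π t) := by
    intro G l hG
    rw [Finset.sum_add_distrib, hG.sum_sub fun x => (π x : ℤ)]
    simp
  rw [← key F k h, ← key F' d h', ← Finset.sum_inter_add_sum_sdiff F F',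
    ← Finset.sum_inter_add_sum_sdiff F' F, Finset.inter_comm F' F]
  -- The summand is the reduced cost. By slackness it is nonpositive on `F` and nonnegative on the
  -- rest of `E`, so `F` minimizes its sum over all subsets of `E`.
  have h1 : ∑ e ∈ F \ F', (1 + ((π e.1 : ℤ) - π e.2)) ≤ 0 := by
    refine Finset.sum_nonpos fun e he => ?_
    have := (hπ e (hF (Finset.mem_sdiff.1 he).1)).1 (Finset.mem_sdiff.1 he).1
    omega
  have h2 : 0 ≤ ∑ e ∈ F' \ F, (1 + ((π e.1 : ℤ) - π e.2)) := by
    refine Finset.sum_nonneg fun e he => ?_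
    have := (hπ e (hF' (Finset.mem_sdiff.1 he).1)).2 (Finset.mem_sdiff.1 he).2
    omega
  omega

/-- A flow that is certified by a potential with a large value at `t` is either complete or shows
that the demand is infeasible. -/
theorem IsSlack.min_of_le {E F : Finset (V × V)} {π : V → ℕ} (hπ : IsSlack E F π) (hF : F ⊆ E)
    {s t : V} {k d : ℕ} (h : IsFlow F s t k) (hs : π s = 0) (hk : k ≤ d)
    (hbig : k < d → k + π t = 2 * E.card + 1) (hE : HasDisjointPaths E s t d) :
    HasDisjointPaths F s t d ∧
      ∀ F' ⊆ E, HasDisjointPaths F' s t d → F.card ≤ F'.card := by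
  by_cases hst : s = t
  -- The empty set is a flow from `s` to `s` as well, and comparing with it forces `F` to be empty.
  · subst hst
    have := hπ.card_le hF (Finset.empty_subset E) h ((isFlow_empty s s).of_eq 0)
    refine ⟨hasDisjointPaths_self F s d, fun F' _ _ => ?_⟩
    simp at this
    simp [this]
  · have hkd : k = d := by
      by_contra hne
      have hlt : k < d := lt_of_le_of_ne hk hne
      obtain ⟨F₀, h₀, hf⟩ := hE.exists_isFlow
      have h1 := hπ.card_le hF h₀ h hf
      have h2 : (k : ℤ) ≤ F.card := by
        have := netOut_le_card F s
        rw [h s] at this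
        simpa [hst] using this
      have h3 := Finset.card_le_card hF
      have h4 := Finset.card_le_card h₀
      have h5 := hbig hlt
      -- With `π s = 0`, weak duality reads `(d - k) * π t ≤ F₀.card - F.card`, and `d - k ≥ 1`. Now
      -- `k` and `π t` are both at most `E.card`, against `hbig`.
      have h6 : π t ≤ F₀.card := by
        rw [hs] at h1
        have : (0 : ℤ) ≤ ((d : ℤ) - k - 1) * π t := by
          apply mul_nonneg <;> omega
        push_cast at h1
        zify
        nlinarith
      omega
    subst hkd
    refine ⟨h.hasDisjointPaths, fun F' hF' hP => ?_⟩
    obtain ⟨F₀, h₀, hf⟩ := hP.exists_isFlow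
    have h1 := hπ.card_le hF (h₀.trans hF') h hf
    have h2 := Finset.card_le_card h₀
    omega

end Flows

/-! ### The approximation ratio. -/

namespace DSNInstance

variable (I : DSNInstance)

theorem IsMinEdgeSet.eq_empty {I : DSNInstance} {s t : Fin I.n} {d : ℕ}
    {F : Finset (Fin I.n × Fin I.n)} (h : I.IsMinEdgeSet s t d F)
    (h0 : HasDisjointPaths (∅ : Finset (Fin I.n × Fin I.n)) s t d) : F = ∅ := by
  simpa using h.2.2 ∅ (by simp) h0

theorem exists_edges_of_isDirectedPath {V : Type*} {F : Finset (V × V)} {s t : V} {p : List V}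
    (h : IsDirectedPath F s t p) (hst : s ≠ t) : (∃ e ∈ F, e.1 = s) ∧ ∃ e ∈ F, e.2 = t := by
  obtain ⟨hs, ht, -, hF⟩ := h
  constructor
  · match p, hs, ht, hF with
    | [a], hs, ht, _ => simp_all
    | a :: b :: l, hs, _, hF => exact ⟨(a, b), hF _ (by simp [pathEdges]), by simpa using hs⟩
  · induction p generalizing s with
    | nil => simp at hs
    | cons a l ih =>
      cases l with
      | nil => simp_all
      | cons b l =>
        have hF' : ∀ e ∈ pathEdges (b :: l), e ∈ F := fun e he => hF e (by
          simp only [pathEdges, List.tail_cons, List.zip_cons_cons, List.mem_cons] at he ⊢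
          exact Or.inr he)
        by_cases hbt : b = t
        · exact ⟨(a, b), hF _ (by simp [pathEdges]), hbt⟩
        · exact ih hbt rfl (by simpa using ht) hF'

/-- The union of minimum edge sets for the single terminal pairs has at most `OPT ^ 3` edges. -/
theorem card_biUnion_le (hsol : ∃ F, I.IsSolution F)
    (E : (Fin I.n × Fin I.n) × ℕ → Finset (Fin I.n × Fin I.n))
    (hE : ∀ q ∈ I.demands, I.IsMinEdgeSet q.1.1 q.1.2 q.2 (E q)) :
    (I.demands.toFinset.biUnion E).card ≤ I.opt ^ 2 * I.opt := by
  obtain ⟨F₀, hF₀⟩ := hsol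
  have hne : {c | ∃ F, I.IsSolution F ∧ F.card = c}.Nonempty := ⟨_, F₀, hF₀, rfl⟩
  obtain ⟨F, hF, hc⟩ : ∃ F, I.IsSolution F ∧ F.card = I.opt := Nat.sInf_mem hne
  set D := I.demands.toFinset.filter fun q => (E q).Nonempty with hD
  have hsub : I.demands.toFinset.biUnion E ⊆ D.biUnion E := by
    intro e he
    obtain ⟨q, hq, hqe⟩ := Finset.mem_biUnion.1 he
    exact Finset.mem_biUnion.2 ⟨q, Finset.mem_filter.2 ⟨hq, e, hqe⟩, hqe⟩
  have hEc : ∀ q ∈ D, (E q).card ≤ I.opt := by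
    intro q hq
    have hq' := List.mem_toFinset.1 (Finset.mem_filter.1 hq).1
    rw [← hc]
    exact (hE q hq').2.2 F hF.1 (hF.2 q hq')
  -- Only pairs with a nonempty minimum edge set count; they embed into tails times heads of the
  -- optimal solution `F`.
  have hDc : D.card ≤ I.opt ^ 2 := by
    have hinj : Set.InjOn Prod.fst (D : Set ((Fin I.n × Fin I.n) × ℕ)) := by
      intro q hq q' hq' hqq
      have h1 := List.mem_toFinset.1 (Finset.mem_filter.1 hq).1
      have h2 := List.mem_toFinset.1 (Finset.mem_filter.1 hq').1
      exact List.inj_on_of_nodup_map I.terminals_nodup h1 h2 hqq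
    rw [← Finset.card_image_of_injOn hinj]
    have himg : D.image Prod.fst ⊆ F.image Prod.fst ×ˢ F.image Prod.snd := by
      intro st hst
      obtain ⟨q, hq, rfl⟩ := Finset.mem_image.1 hst
      obtain ⟨hq1, hq2⟩ := Finset.mem_filter.1 hq
      have hq' := List.mem_toFinset.1 hq1
      have hne' : q.1.1 ≠ q.1.2 := by
        intro h
        have := (hE q hq').eq_empty (by rw [h]; exact hasDisjointPaths_self _ _ _)
        simp [this] at hq2
      obtain ⟨P, hP, -⟩ := hF.2 q hq'
      have hpos : 0 < q.2 := by
        rcases Nat.eq_zero_or_pos q.2 with h | h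
        · have := (hE q hq').eq_empty (by rw [h]; exact hasDisjointPaths_zero _ _ _)
          simp [this] at hq2
        · exact h
      obtain ⟨⟨e, he, hes⟩, ⟨e', he', het⟩⟩ := exists_edges_of_isDirectedPath (hP ⟨0, hpos⟩) hne'
      exact Finset.mem_product.2
        ⟨Finset.mem_image.2 ⟨e, he, hes⟩, Finset.mem_image.2 ⟨e', he', het⟩⟩
    calc _ ≤ _ := Finset.card_le_card himg
      _ = (F.image Prod.fst).card * (F.image Prod.snd).card := Finset.card_product _ _
      _ ≤ F.card * F.card := Nat.mul_le_mul Finset.card_image_le Finset.card_image_le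
      _ = I.opt ^ 2 := by rw [hc, sq]
  calc _ ≤ _ := Finset.card_le_card hsub
    _ ≤ D.card * I.opt := Finset.card_biUnion_le_card_mul _ _ _ hEc
    _ ≤ _ := Nat.mul_le_mul_right _ hDc

end DSNInstance

/-! ### Total correctness with time bounds for machine programs. -/

namespace RAM

@[simp] theorem Mem.set_same (σ : Mem) (b i v : ℕ) : σ.set b i v b = Function.update (σ b) i v := by
  funext j; simp [Mem.set, Function.update_apply]

theorem Mem.set_ne {σ : Mem} {b b' : ℕ} (i v : ℕ) (h : b' ≠ b) : σ.set b i v b' = σ b' := by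
  funext j; simp [Mem.set, h]

/-- Started in memory `σ`, the program `p` halts after at most `T` steps in a memory that
satisfies `Q`. -/
def Wp (p : Prog) (T : ℕ) (Q : Mem → Prop) (σ : Mem) : Prop :=
  ∃ σ' t, Runs p σ σ' t ∧ t ≤ T ∧ Q σ'

theorem Wp.mono {p : Prog} {T T' : ℕ} {Q Q' : Mem → Prop} {σ : Mem} (h : Wp p T Q σ)
    (hT : T ≤ T') (hQ : ∀ σ', Q σ' → Q' σ') : Wp p T' Q' σ := by
  obtain ⟨σ', t, hr, ht, hq⟩ := h
  exact ⟨σ', t, hr, ht.trans hT, hQ σ' hq⟩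

theorem Wp.seq {p q : Prog} {T T' : ℕ} {R Q : Mem → Prop} {σ : Mem} (hp : Wp p T R σ)
    (hq : ∀ σ', R σ' → Wp q T' Q σ') : Wp (.seq p q) (T + T') Q σ := by
  obtain ⟨σ', t, hr, ht, h⟩ := hp
  obtain ⟨σ'', t', hr', ht', h'⟩ := hq σ' h
  exact ⟨σ'', t + t', .seq hr hr', by omega, h'⟩

theorem Wp.ite {e : Expr} {p q : Prog} {T : ℕ} {Q : Mem → Prop} {σ : Mem}
    (hp : e.eval σ ≠ 0 → Wp p T Q σ) (hq : e.eval σ = 0 → Wp q T Q σ) :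
    Wp (.ite e p q) (e.cost + 1 + T) Q σ := by
  by_cases he : e.eval σ = 0
  · obtain ⟨σ', t, hr, ht, h⟩ := hq he
    exact ⟨σ', _, .ite_false p he hr, by omega, h⟩
  · obtain ⟨σ', t, hr, ht, h⟩ := hp he
    exact ⟨σ', _, .ite_true q he hr, by omega, h⟩

/-- Programs without loops. -/
def Prog.LoopFree : Prog → Bool
  | .skip => true
  | .write _ _ _ => true
  | .seq p q => p.LoopFree && q.LoopFree
  | .ite _ p q => p.LoopFree && q.LoopFree
  | .loop _ _ => false

/-- The effect of a program without loops. -/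
def Prog.exec : Prog → Mem → Mem
  | .skip, σ => σ
  | .write b i e, σ => σ.set b (i.eval σ) (e.eval σ)
  | .seq p q, σ => q.exec (p.exec σ)
  | .ite e p q, σ => if e.eval σ = 0 then q.exec σ else p.exec σ
  | .loop _ _, σ => σ

theorem Prog.exec_ite_of_eq_zero {e : Expr} (p q : Prog) {σ : Mem} (h : e.eval σ = 0) :
    (Prog.ite e p q).exec σ = q.exec σ := if_pos h

theorem Prog.exec_ite_of_ne_zero {e : Expr} (p q : Prog) {σ : Mem} (h : e.eval σ ≠ 0) :
    (Prog.ite e p q).exec σ = p.exec σ := if_neg h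

/-- A bound for the number of steps of a program without loops. -/
def Prog.maxCost : Prog → ℕ
  | .skip => 1
  | .write _ i e => i.cost + e.cost + 1
  | .seq p q => p.maxCost + q.maxCost
  | .ite e p q => e.cost + 1 + (p.maxCost + q.maxCost)
  | .loop _ _ => 0

theorem Prog.LoopFree.runs {p : Prog} (hp : p.LoopFree = true) (σ : Mem) :
    ∃ t, Runs p σ (p.exec σ) t ∧ t ≤ p.maxCost := by
  induction p generalizing σ with
  | skip => exact ⟨_, .skip σ, le_rfl⟩
  | write b i e => exact ⟨_, .write σ b i e, le_rfl⟩
  | seq p q ihp ihq =>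
    simp only [LoopFree, Bool.and_eq_true] at hp
    obtain ⟨t, ht, hl⟩ := ihp hp.1 σ
    obtain ⟨t', ht', hl'⟩ := ihq hp.2 (p.exec σ)
    exact ⟨_, .seq ht ht', Nat.add_le_add hl hl'⟩
  | ite e p q ihp ihq =>
    simp only [LoopFree, Bool.and_eq_true] at hp
    obtain ⟨t, ht, hl⟩ := ihp hp.1 σ
    obtain ⟨t', ht', hl'⟩ := ihq hp.2 σ
    simp only [exec, maxCost]
    split_ifs with he
    · exact ⟨_, .ite_false p he ht', by omega⟩
    · exact ⟨_, .ite_true q he ht, by omega⟩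
  | loop => simp [LoopFree] at hp

theorem Wp.of_loopFree {p : Prog} {T : ℕ} {Q : Mem → Prop} {σ : Mem} (hp : p.LoopFree = true)
    (hT : p.maxCost ≤ T) (hQ : Q (p.exec σ)) : Wp p T Q σ := by
  obtain ⟨t, ht, hl⟩ := Prog.LoopFree.runs hp σ
  exact ⟨_, t, ht, hl.trans hT, hQ⟩

/-- Total correctness of a loop with the invariant `inv` and the variant `μ`. -/
theorem Wp.loop {e : Expr} {p : Prog} {T : ℕ} (inv : Mem → Prop) (μ : Mem → ℕ) {Q : Mem → Prop}
    (hstep : ∀ σ, inv σ → e.eval σ ≠ 0 → Wp p T (fun σ' => inv σ' ∧ μ σ' < μ σ) σ)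
    (hQ : ∀ σ, inv σ → e.eval σ = 0 → Q σ) (N : ℕ) (σ : Mem) (hN : μ σ ≤ N) (h : inv σ) :
    Wp (.loop e p) ((N + 1) * (T + e.cost + 1)) Q σ := by
  induction N generalizing σ with
  | zero =>
    by_cases he : e.eval σ = 0
    · exact ⟨σ, _, .loop_done p he, by omega, hQ σ h he⟩
    · obtain ⟨σ', t, hr, ht, h', hlt⟩ := hstep σ h he
      omega
  | succ N ih =>
    by_cases he : e.eval σ = 0
    · refine ⟨σ, _, .loop_done p he, ?_, hQ σ h he⟩
      nlinarith
    · obtain ⟨σ', t, hr, ht, h', hlt⟩ := hstep σ h he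
      obtain ⟨σ'', t', hr', ht', hq⟩ := ih σ' (by omega) h'
      refine ⟨σ'', _, .loop_step he hr hr', ?_, hq⟩
      rw [Nat.succ_mul (N + 1)]
      omega

/-- The content of cell `0` of bank `b`, which serves as a variable. -/
abbrev var (b : ℕ) : Expr := .read b (.const 0)

/-- Assignment to a variable. -/
abbrev Prog.assign (b : ℕ) (e : Expr) : Prog := .write b (.const 0) e

/-- Execute `p` with the variable `b` running from `0` to `N - 1`, where `N` is the value
of `e`. -/
def Prog.forLoop (b : ℕ) (e : Expr) (p : Prog) : Prog :=
  .seq (.assign b (.const 0))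
    (.loop (.sub e (var b)) (.seq p (.assign b (.add (var b) (.const 1)))))

/-- The bound `e` is evaluated anew in each round, so `inv` has to fix its value. The body must
leave the counter as it found it, and `inv` is asserted after the counter has been set. The `10`
pays for test and increment, the `3` for the initialization. -/
theorem Wp.forLoop {b : ℕ} {e : Expr} {p : Prog} {T N : ℕ} (inv : ℕ → Mem → Prop) {Q : Mem → Prop}
    {σ : Mem} (h0 : inv 0 (σ.set b 0 0)) (hN : ∀ i σ, inv i σ → e.eval σ = N)
    (hstep : ∀ i σ, i < N → σ b 0 = i → inv i σ →
      Wp p T (fun σ' => σ' b 0 = i ∧ inv (i + 1) (σ'.set b 0 (i + 1))) σ)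
    (hQ : ∀ σ, inv N σ → Q σ) :
    Wp (.forLoop b e p) ((N + 1) * (T + e.cost + 10) + 3) Q σ := by
  have h1 : Wp (.assign b (.const 0)) 3 (fun σ' => inv 0 σ' ∧ σ' b 0 = 0) σ :=
    Wp.of_loopFree rfl le_rfl ⟨h0, by simp [Prog.exec, Expr.eval]⟩
  rw [add_comm]
  refine h1.seq fun σ₁ ⟨hi, hb⟩ => ?_
  refine (Wp.loop (T := T + 6) (fun σ => ∃ i, inv i σ ∧ σ b 0 = i ∧ i ≤ N)
    (fun σ => N - σ b 0) ?_ ?_ N σ₁ (Nat.sub_le _ _) ⟨0, hi, hb, Nat.zero_le _⟩).mono ?_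
    (fun _ h => h)
  · rintro σ ⟨i, hi, hb, hle⟩ he
    have hv : (Expr.sub e (var b)).eval σ = N - i := by simp [Expr.eval, hN i σ hi, hb]
    have hlt : i < N := by omega
    refine (hstep i σ hlt hb hi).seq fun σ' ⟨hb', hi'⟩ => Wp.of_loopFree rfl le_rfl ?_
    simp only [Prog.exec, Expr.eval, hb']
    exact ⟨⟨i + 1, hi', by simp, hlt⟩, by simp [hb]; omega⟩
  · rintro σ ⟨i, hi, hb, hle⟩ he
    have hv : (Expr.sub e (var b)).eval σ = N - i := by simp [Expr.eval, hN i σ hi, hb]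
    have : i = N := by omega
    exact hQ σ (this ▸ hi)
  · simp only [Expr.cost]
    apply Nat.mul_le_mul_left
    omega

end RAM

namespace RAM

/-- The memories `σ` and `σ'` agree outside the banks in `S`. -/
def SameOff (S : List ℕ) (σ σ' : Mem) : Prop := ∀ b, b ∉ S → σ' b = σ b

theorem SameOff.refl (S : List ℕ) (σ : Mem) : SameOff S σ σ := fun _ _ => rfl

theorem SameOff.set {S : List ℕ} {σ σ' : Mem} (h : SameOff S σ σ') {b : ℕ} (hb : b ∈ S)
    (i v : ℕ) : SameOff S σ (σ'.set b i v) := fun b' hb' => by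
  rw [Mem.set_ne i v (by rintro rfl; exact hb' hb), h b' hb']

theorem SameOff.trans {S S' : List ℕ} {σ₁ σ₂ σ₃ : Mem} (h : SameOff S σ₁ σ₂)
    (h' : SameOff S' σ₂ σ₃) (hS : S ⊆ S') : SameOff S' σ₁ σ₃ := fun b hb => by
  rw [h' b hb, h b fun h => hb (hS h)]

end RAM

/-! ## The program -/

namespace DSNProgram

open RAM

/-- The number of vertices. -/
abbrev nE : Expr := .read 0 (.const 0)
/-- The number of edges. -/
abbrev mE : Expr := .read 0 (.const 1)
/-- The tail of the edge whose index is in variable `10`. -/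
abbrev srcE : Expr := .read 0 (.add (.const 2) (.add (var 10) (var 10)))
/-- The head of the edge whose index is in variable `10`. -/
abbrev dstE : Expr := .read 0 (.add (.const 3) (.add (var 10) (var 10)))
/-- The number of terminal pairs. -/
abbrev kE : Expr := .read 0 (.add (.const 2) (.add mE mE))
/-- The data of the terminal pair whose index is in variable `7`: the source for `c = 3`, the
target for `c = 4` and the demand for `c = 5`. -/
abbrev demE (c : ℕ) : Expr :=
  .read 0 (.add (.const c) (.add (.add mE mE) (.add (var 7) (.add (var 7) (var 7)))))

/-- Store `0` in the first cells of bank `b`. -/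
def clear (c : ℕ) (e : Expr) (b : ℕ) : Prog := .forLoop c e (.write b (var c) (.const 0))

/-- If the level (bank `4`) of the vertex `x` is positive and the one of `y` is `0`, then `y`
becomes a child of `x`, and the current edge is stored in bank `5`. -/
def mark (x y : Expr) : Prog :=
  .ite (.read 4 x) (.ite (.read 4 y) .skip
    (.seq (.write 5 y (var 10)) (.write 4 y (.add (.read 4 x) (.const 1))))) .skip

/-- Extend the search tree along the current edge, if it is tight for the potential in bank `3`;
bank `2` tells whether the edge is used by the flow. -/
def relax : Prog :=
  .ite (.read 2 (var 10))
    (.ite (.sub (.read 3 dstE) (.add (.read 3 srcE) (.const 1))) .skip (mark dstE srcE))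
    (.ite (.sub (.add (.read 3 srcE) (.const 1)) (.read 3 dstE)) .skip (mark srcE dstE))

/-- Search the vertices that are reachable from the source along tight residual edges. -/
def search : Prog :=
  .seq (clear 13 nE 4) (.seq (.write 4 (demE 3) (.const 1))
    (.forLoop 9 nE (.forLoop 10 mE relax)))

/-- Move variable `12` to the parent vertex and toggle the edge. -/
def backStep : Prog :=
  .seq (.assign 10 (.read 5 (var 12)))
    (.ite (.read 2 (var 10))
      (.seq (.write 2 (var 10) (.const 0)) (.assign 12 dstE))
      (.seq (.write 2 (var 10) (.const 1)) (.assign 12 srcE)))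

/-- Augment the flow along the path to the target in the search tree. -/
def augment : Prog :=
  .seq (.assign 12 (demE 4))
    (.seq (.loop (.add (.sub (var 12) (demE 3)) (.sub (demE 3) (var 12))) backStep)
      (.assign 11 (.add (var 11) (.const 1))))

/-- Increase the potential of the vertices that have not been found. -/
def raise : Prog :=
  .forLoop 13 nE (.ite (.read 4 (var 13)) .skip
    (.write 3 (var 13) (.add (.read 3 (var 13)) (.const 1))))

/-- One augmentation or one increase of the potential. -/
def phase : Prog :=
  .ite (.sub (demE 5) (var 11))
    (.seq search (.ite (.read 4 (demE 4)) augment raise)) .skip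

/-- Add the edges of the flow to the output set in bank `6`. -/
def collect : Prog :=
  .forLoop 10 mE (.write 6 (var 10) (.add (.read 6 (var 10)) (.read 2 (var 10))))

/-- Treat one terminal pair. -/
def treatPair : Prog :=
  .seq (clear 10 mE 2) (.seq (clear 13 nE 3) (.seq (.assign 11 (.const 0))
    (.seq (.forLoop 8 (.add (.add mE mE) (.const 1)) phase) collect)))

/-- Write the edges in the output set to the output bank. -/
def emit : Prog :=
  .forLoop 10 mE (.ite (.read 6 (var 10))
    (.seq (.write 1 (.add (var 1) (.const 1)) srcE)
      (.seq (.write 1 (.add (var 1) (.const 2)) dstE)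
        (.assign 1 (.add (var 1) (.const 2))))) .skip)

/-- The algorithm: the union of the minimum edge sets of the single terminal pairs. -/
def main : Prog := .seq (.forLoop 7 kE treatPair) emit

/-! ## Search -/

section Search

variable (a : ℕ → ℕ)

/-- The tail of edge `j` in the input `a`. -/
abbrev src (j : ℕ) : ℕ := a (2 + (j + j))
/-- The head of edge `j` in the input `a`. -/
abbrev dst (j : ℕ) : ℕ := a (3 + (j + j))

/-- The endpoints of all edges of the input `a` are vertices. -/
def EdgesInRange : Prop := ∀ j < a 1, src a j < a 0 ∧ dst a j < a 0

/-- Complementary slackness for the flow given by the flags `f` and the potential `π`. -/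
def Slack (f π : ℕ → ℕ) : Prop :=
  ∀ j < a 1, (f j ≠ 0 → π (src a j) + 1 ≤ π (dst a j)) ∧
    (f j = 0 → π (dst a j) ≤ π (src a j) + 1)

/-- Edge `j` gives a tight residual edge from `x` to `y`. -/
def Arc (f π : ℕ → ℕ) (j x y : ℕ) : Prop :=
  j < a 1 ∧ π (dst a j) = π (src a j) + 1 ∧
    (f j = 0 ∧ x = src a j ∧ y = dst a j ∨ f j ≠ 0 ∧ x = dst a j ∧ y = src a j)

/-- The levels `lev` and the parent edges `par` describe a tree with root `s`. -/
def IsTree (f π : ℕ → ℕ) (s B : ℕ) (lev par : ℕ → ℕ) : Prop :=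
  lev s ≠ 0 ∧ ∀ x < a 0, lev x ≠ 0 → lev x ≤ B ∧
    (x = s ∨ ∃ y, Arc a f π (par x) y x ∧ lev y ≠ 0 ∧ lev y < lev x)

/-- No tight residual edge leaves the set of vertices with a positive level. -/
def IsClosed (f π lev : ℕ → ℕ) : Prop :=
  ∀ j x y, Arc a f π j x y → lev x ≠ 0 → lev y ≠ 0

/-- The number of vertices with a positive level. -/
def count (lev : ℕ → ℕ) : ℕ := ((Finset.range (a 0)).filter fun x => lev x ≠ 0).card

variable {a}

theorem count_update {lev : ℕ → ℕ} {y c : ℕ} (hy : y < a 0) (h0 : lev y = 0) (hc : c ≠ 0) :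
    count a (Function.update lev y c) = count a lev + 1 := by
  have : (Finset.range (a 0)).filter (fun x => Function.update lev y c x ≠ 0) =
      insert y ((Finset.range (a 0)).filter fun x => lev x ≠ 0) := by
    ext x
    by_cases hx : x = y
    · subst hx; simp [hy, hc]
    · simp [hx]
  rw [count, this, Finset.card_insert_of_notMem (by simp [h0]), count]

theorem Arc.lt {f π : ℕ → ℕ} {j x y : ℕ} (hr : EdgesInRange a) (h : Arc a f π j x y) :
    x < a 0 ∧ y < a 0 := by
  obtain ⟨hj, -, ⟨-, rfl, rfl⟩ | ⟨-, rfl, rfl⟩⟩ := h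
  · exact hr j hj
  · exact (hr j hj).symm

theorem IsTree.mono {f π lev par : ℕ → ℕ} {s B B' : ℕ} (h : IsTree a f π s B lev par)
    (hB : B ≤ B') : IsTree a f π s B' lev par :=
  ⟨h.1, fun x hx h0 => ⟨(h.2 x hx h0).1.trans hB, (h.2 x hx h0).2⟩⟩

/-- The new vertex `y` had level `0`, so it is neither the root nor the parent witness of any marked
vertex; overwriting its entries keeps the old tree. -/
theorem IsTree.extend {f π lev par : ℕ → ℕ} {s B j x y : ℕ} (hr : EdgesInRange a)
    (h : IsTree a f π s B lev par) (harc : Arc a f π j x y) (hx : lev x ≠ 0) (hy : lev y = 0) :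
    IsTree a f π s (B + 1) (Function.update lev y (lev x + 1)) (Function.update par y j) := by
  have hxy : x ≠ y := by rintro rfl; exact hx hy
  have hsy : s ≠ y := by rintro rfl; exact h.1 hy
  refine ⟨by simpa [hsy] using h.1, fun z hz h0 => ?_⟩
  by_cases hzy : z = y
  · subst hzy
    have := (h.2 x (harc.lt hr).1 hx).1
    exact ⟨by simpa using this, .inr ⟨x, by simpa using harc, by simpa [hxy] using hx,
      by simp [hxy]⟩⟩
  · rw [Function.update_of_ne hzy] at h0 ⊢
    obtain ⟨hB, hp⟩ := h.2 z hz h0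
    refine ⟨by omega, hp.imp_right ?_⟩
    rintro ⟨w, hw, hw0, hlt⟩
    have hwy : w ≠ y := by rintro rfl; exact hw0 hy
    exact ⟨w, by simpa [hzy] using hw, by simpa [hwy] using hw0, by simpa [hwy] using hlt⟩

/-- By slackness the truncated difference tested by the program vanishes exactly when the edge is
tight. -/
theorem exec_relax {σ : Mem} (ha : σ 0 = a) (hs : Slack a (σ 2) (σ 3)) (hj : σ 10 0 < a 1) :
    (relax.exec σ = σ ∧
      ∀ x y, Arc a (σ 2) (σ 3) (σ 10 0) x y → σ 4 x ≠ 0 → σ 4 y ≠ 0) ∨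
    ∃ x y, Arc a (σ 2) (σ 3) (σ 10 0) x y ∧ σ 4 x ≠ 0 ∧ σ 4 y = 0 ∧
      relax.exec σ = (σ.set 5 y (σ 10 0)).set 4 y (σ 4 x + 1) := by
  obtain ⟨h1, h2⟩ := hs _ hj
  simp only [relax, mark, Prog.exec, Expr.eval, ha]
  simp only [Mem.set_ne (b := 5) (b' := 4) _ _ (by decide),
    Mem.set_ne (b := 5) (b' := 10) _ _ (by decide), Mem.set_ne (b := 5) (b' := 0) _ _ (by decide),
    ha]
  generalize σ 10 0 = j at *
  by_cases hf : σ 2 j = 0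
  · rw [if_pos hf]
    by_cases ht : σ 3 (src a j) + 1 - σ 3 (dst a j) = 0
    · have htight : σ 3 (dst a j) = σ 3 (src a j) + 1 := by have := h2 hf; omega
      rw [if_pos ht]
      by_cases hx : σ 4 (src a j) = 0
      · rw [if_pos hx]
        refine .inl ⟨rfl, ?_⟩
        rintro x y ⟨-, -, ⟨-, rfl, rfl⟩ | ⟨h, -⟩⟩ hx'
        · exact absurd hx hx'
        · exact absurd hf h
      · rw [if_neg hx]
        by_cases hy : σ 4 (dst a j) = 0
        · rw [if_pos hy]
          exact .inr ⟨_, _, ⟨hj, htight, .inl ⟨hf, rfl, rfl⟩⟩, hx, hy, rfl⟩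
        · rw [if_neg hy]
          refine .inl ⟨rfl, ?_⟩
          rintro x y ⟨-, -, ⟨-, rfl, rfl⟩ | ⟨h, -⟩⟩ hx'
          · exact hy
          · exact absurd hf h
    · rw [if_neg ht]
      refine .inl ⟨rfl, ?_⟩
      rintro x y ⟨-, h, -⟩
      omega
  · rw [if_neg hf]
    by_cases ht : σ 3 (dst a j) - (σ 3 (src a j) + 1) = 0
    · have htight : σ 3 (dst a j) = σ 3 (src a j) + 1 := by have := h1 hf; omega
      rw [if_pos ht]
      by_cases hx : σ 4 (dst a j) = 0
      · rw [if_pos hx]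
        refine .inl ⟨rfl, ?_⟩
        rintro x y ⟨-, -, ⟨h, -⟩ | ⟨-, rfl, rfl⟩⟩ hx'
        · exact absurd h hf
        · exact absurd hx hx'
      · rw [if_neg hx]
        by_cases hy : σ 4 (src a j) = 0
        · rw [if_pos hy]
          exact .inr ⟨_, _, ⟨hj, htight, .inr ⟨hf, rfl, rfl⟩⟩, hx, hy, rfl⟩
        · rw [if_neg hy]
          refine .inl ⟨rfl, ?_⟩
          rintro x y ⟨-, -, ⟨h, -⟩ | ⟨-, rfl, rfl⟩⟩ hx'
          · exact absurd h hf
          · exact hy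
    · rw [if_neg ht]
      refine .inl ⟨rfl, ?_⟩
      rintro x y ⟨-, h, -⟩
      omega

theorem wp_clear {c b N : ℕ} {e : Expr} (hcb : c ≠ b) (σ : Mem)
    (hN : ∀ σ', SameOff [c, b] σ σ' → e.eval σ' = N) :
    Wp (clear c e b) ((N + 1) * (e.cost + 14) + 3)
      (fun σ' => SameOff [c, b] σ σ' ∧ ∀ i < N, σ' b i = 0) σ := by
  refine (Wp.forLoop (T := 4) (N := N)
    (fun i σ' => SameOff [c, b] σ σ' ∧ ∀ i' < i, σ' b i' = 0) ?_ ?_ ?_ fun σ' h => h).mono ?_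
    fun σ' h => h
  · exact ⟨(SameOff.refl _ _).set (by simp) _ _, by simp⟩
  · exact fun i σ' h => hN σ' h.1
  · rintro i σ' hi hc ⟨h1, h2⟩
    refine Wp.of_loopFree rfl le_rfl ?_
    simp only [Prog.exec, Expr.eval, hc]
    refine ⟨by rw [Mem.set_ne _ _ hcb, hc], (h1.set (by simp) _ _).set (by simp) _ _, ?_⟩
    intro i' hi'
    rw [Mem.set_ne _ _ hcb.symm, Mem.set_same, Function.update_apply]
    split_ifs with h
    · rfl
    · exact h2 i' (by omega)
  · exact Nat.add_le_add_right (Nat.mul_le_mul_left _ (by omega)) _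

/-- One round in the style of Bellman and Ford: if nothing is marked, the marked set is closed. Each
edge raises the largest level by at most one, hence the bound `B + a 1`. -/
theorem wp_pass {σ : Mem} {s B : ℕ} (hr : EdgesInRange a) (ha : σ 0 = a)
    (hs : Slack a (σ 2) (σ 3)) (ht : IsTree a (σ 2) (σ 3) s B (σ 4) (σ 5)) :
    Wp (.forLoop 10 mE relax) ((a 1 + 1) * 220 + 3)
      (fun σ' => SameOff [4, 5, 10] σ σ' ∧ IsTree a (σ 2) (σ 3) s (B + a 1) (σ' 4) (σ' 5) ∧
        (σ' 4 = σ 4 ∧ IsClosed a (σ 2) (σ 3) (σ 4) ∨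
          count a (σ 4) + 1 ≤ count a (σ' 4) ∧ ¬ IsClosed a (σ 2) (σ 3) (σ 4))) σ := by
  refine (Wp.forLoop (T := 200) (N := a 1) (fun i σ' => SameOff [4, 5, 10] σ σ' ∧
    IsTree a (σ 2) (σ 3) s (B + i) (σ' 4) (σ' 5) ∧
      (σ' 4 = σ 4 ∧ (∀ j < i, ∀ x y, Arc a (σ 2) (σ 3) j x y → σ 4 x ≠ 0 → σ 4 y ≠ 0) ∨
        count a (σ 4) + 1 ≤ count a (σ' 4) ∧ ¬ IsClosed a (σ 2) (σ 3) (σ 4)))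
    ?_ ?_ ?_ ?_).mono ?_ fun σ' h => h
  · exact ⟨(SameOff.refl _ _).set (by simp) _ _, ht, .inl ⟨rfl, by simp⟩⟩
  · rintro i σ' ⟨h, -⟩
    simp [Expr.eval, h 0 (by decide), ha]
  · rintro i σ' hi hc ⟨h1, h2, h3⟩
    refine Wp.of_loopFree rfl (by decide) ?_
    have e0 : σ' 0 = a := by rw [h1 0 (by decide), ha]
    have e2 := h1 2 (by decide)
    have e3 := h1 3 (by decide)
    have key := exec_relax e0 (by rwa [e2, e3]) (by rwa [hc])
    rw [e2, e3, hc] at key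
    rcases key with ⟨he, hcl⟩ | ⟨x, y, harc, hx, hy, he⟩
    · rw [he]
      refine ⟨hc, h1.set (by simp) _ _, ?_, ?_⟩
      · simp only [Mem.set_ne (b := 10) (b' := 4) _ _ (by decide),
          Mem.set_ne (b := 10) (b' := 5) _ _ (by decide)]
        exact h2.mono (by omega)
      · simp only [Mem.set_ne (b := 10) (b' := 4) _ _ (by decide)]
        refine h3.imp_left fun h => ⟨h.1, fun j hj => ?_⟩
        rcases Nat.lt_succ_iff_lt_or_eq.1 hj with hj | rfl
        · exact h.2 j hj
        · rwa [h.1] at hcl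
    · rw [he]
      refine ⟨by simp [Mem.set_ne, hc], ((h1.set (by simp) _ _).set (by simp) _ _).set
        (by simp) _ _, ?_, ?_⟩
      · have := h2.extend hr harc hx hy
        simpa [Mem.set_ne, add_assoc] using this
      · have hcnt := count_update (a := a) (lev := σ' 4) (c := σ' 4 x + 1) (harc.lt hr).2 hy
          (by omega)
        right
        simp only [Mem.set_ne (b := 10) (b' := 4) _ _ (by decide), Mem.set_same,
          Mem.set_ne (b := 5) (b' := 4) _ _ (by decide), hcnt]
        rcases h3 with ⟨h, -⟩ | ⟨h, h'⟩
        · rw [h] at hx hy ⊢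
          exact ⟨le_rfl, fun hcl => hcl _ _ _ harc hx hy⟩
        · exact ⟨by omega, h'⟩
  · rintro σ' ⟨h1, h2, h3⟩
    refine ⟨h1, h2, h3.imp_left fun h => ⟨h.1, fun j x y harc => h.2 j harc.1 x y harc⟩⟩
  · simp only [Expr.cost]; omega

/-- Until the marked set is closed, each pass marks a new vertex, so `a 0` passes suffice. The level
bound later limits the walk back from the target. -/
theorem wp_search {σ : Mem} {s : ℕ} (hr : EdgesInRange a) (ha : σ 0 = a)
    (hs : Slack a (σ 2) (σ 3)) (hsrc : (demE 3).eval σ = s) (hsn : s < a 0) :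
    Wp search ((a 0 + 1) * ((a 1 + 1) * 220 + 20) + 3 + 100 + ((a 0 + 1) * 20 + 3))
      (fun σ' => SameOff [4, 5, 9, 10, 13] σ σ' ∧
        IsTree a (σ 2) (σ 3) s (1 + a 0 * a 1) (σ' 4) (σ' 5) ∧
        IsClosed a (σ 2) (σ 3) (σ' 4)) σ := by
  have h1 := wp_clear (c := 13) (b := 4) (N := a 0) (e := nE) (by decide) σ fun σ' h => by
    simp [Expr.eval, h 0 (by decide), ha]
  refine (h1.seq (T' := (a 0 + 1) * ((a 1 + 1) * 220 + 20) + 3 + 100) fun σ₁ ⟨h1, h2⟩ => ?_).mono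
    (by simp only [Expr.cost]; omega) fun σ' h => h
  have h3 : Wp (.write 4 (demE 3) (.const 1)) 100 (fun σ' => SameOff [4, 5, 9, 10, 13] σ σ' ∧
      IsTree a (σ 2) (σ 3) s 1 (σ' 4) (σ' 5) ∧ 1 ≤ count a (σ' 4)) σ₁ := by
    refine Wp.of_loopFree rfl (by decide) ?_
    have hs' : (demE 3).eval σ₁ = s := by
      rw [← hsrc]
      simp only [Expr.eval, h1 0 (by decide), h1 7 (by decide)]
    simp only [Prog.exec, hs']
    refine ⟨(h1.trans (SameOff.refl _ _) (by simp)).set (by simp) _ _, ?_, ?_⟩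
    -- Bank `5` may hold parents from earlier phases; `IsTree` consults them only at marked
    -- vertices, and so far only the root is marked.
    · simp only [Mem.set_same, Mem.set_ne (b := 4) (b' := 5) _ _ (by decide), Expr.eval]
      refine ⟨by simp, fun x hx h0 => ?_⟩
      have : x = s := by
        by_contra hne
        rw [Function.update_of_ne hne] at h0
        exact h0 (h2 x hx)
      subst this
      simp
    · refine Finset.card_pos.2 ⟨s, ?_⟩
      simp [hsn, Expr.eval]
  refine (h3.seq (T' := (a 0 + 1) * ((a 1 + 1) * 220 + 20) + 3) fun σ₂ ⟨h4, h5, h6⟩ => ?_).mono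
    (by omega) fun σ' h => h
  refine (Wp.forLoop (T := (a 1 + 1) * 220 + 3) (N := a 0)
    (fun r σ' => SameOff [4, 5, 9, 10, 13] σ σ' ∧
      IsTree a (σ 2) (σ 3) s (1 + r * a 1) (σ' 4) (σ' 5) ∧
      (r + 1 ≤ count a (σ' 4) ∨ IsClosed a (σ 2) (σ 3) (σ' 4))) ?_ ?_ ?_ ?_).mono ?_ fun σ' h => h
  · refine ⟨h4.set (by simp) _ _, ?_, ?_⟩
    · simpa [Mem.set_ne] using h5
    · simpa [Mem.set_ne] using Or.inl h6
  · rintro i σ' ⟨h, -⟩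
    simp [Expr.eval, h 0 (by decide), ha]
  · rintro r σ' hi hc ⟨h1, h2, h3⟩
    have e0 : σ' 0 = a := by rw [h1 0 (by decide), ha]
    have e2 := h1 2 (by decide)
    have e3 := h1 3 (by decide)
    have hp := wp_pass (σ := σ') hr e0 (by rwa [e2, e3]) (by rw [e2, e3]; exact h2)
    rw [e2, e3] at hp
    refine hp.mono le_rfl ?_
    rintro σ'' ⟨g1, g2, g3⟩
    refine ⟨by rw [g1 9 (by decide), hc], (h1.trans (g1.trans (SameOff.refl _ _) (by simp))
      (List.Subset.refl _)).set (by simp) _ _, ?_, ?_⟩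
    · simp only [Mem.set_ne (b := 9) (b' := 4) _ _ (by decide),
        Mem.set_ne (b := 9) (b' := 5) _ _ (by decide)]
      exact g2.mono (by rw [Nat.succ_mul]; omega)
    · simp only [Mem.set_ne (b := 9) (b' := 4) _ _ (by decide)]
      rcases g3 with ⟨h, hcl⟩ | ⟨h, hcl⟩
      · rw [h]; exact .inr hcl
      · rcases h3 with h3 | h3
        · exact .inl (by omega)
        · exact absurd h3 hcl
  · rintro σ' ⟨g1, g2, g3⟩
    refine ⟨g1, g2, g3.resolve_left fun h => ?_⟩
    have : count a (σ' 4) ≤ a 0 := (Finset.card_filter_le _ _).trans (by simp)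
    omega
  · simp only [Expr.cost]
    exact Nat.add_le_add_right (Nat.mul_le_mul_left _ (by omega)) _

/-- Raising by one can break slackness only at a tight edge whose residual arc leaves the marked
set, and closedness excludes such arcs. -/
theorem wp_raise {σ : Mem} (hr : EdgesInRange a) (ha : σ 0 = a) (hs : Slack a (σ 2) (σ 3))
    (hcl : IsClosed a (σ 2) (σ 3) (σ 4)) :
    Wp raise ((a 0 + 1) * 40 + 3) (fun σ' => SameOff [3, 13] σ σ' ∧ Slack a (σ 2) (σ' 3) ∧
      ∀ x < a 0, σ' 3 x = if σ 4 x = 0 then σ 3 x + 1 else σ 3 x) σ := by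
  refine (Wp.forLoop (T := 20) (N := a 0) (fun i σ' => SameOff [3, 13] σ σ' ∧
    ∀ x, σ' 3 x = if x < i ∧ σ 4 x = 0 then σ 3 x + 1 else σ 3 x) ?_ ?_ ?_ ?_).mono
    (by simp only [Expr.cost]; omega) fun σ' h => h
  · exact ⟨(SameOff.refl _ _).set (by simp) _ _, by simp [Mem.set_ne]⟩
  · rintro i σ' ⟨h, -⟩
    simp [Expr.eval, h 0 (by decide), ha]
  · rintro i σ' hi hc ⟨h1, h2⟩
    refine Wp.of_loopFree rfl (by decide) ?_
    have he : (Expr.read 4 (var 13)).eval σ' = σ 4 i := by simp [Expr.eval, hc, h1 4 (by decide)]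
    rw [Prog.exec, he]
    split_ifs with h4
    · simp only [Prog.exec, Expr.eval, hc]
      refine ⟨by simp [Mem.set_ne, hc], (h1.set (by simp) _ _).set (by simp) _ _, fun x => ?_⟩
      simp only [Mem.set_ne (b := 13) (b' := 3) _ _ (by decide), Mem.set_same,
        Function.update_apply]
      by_cases hx : x = i
      · subst hx; simp [h2, h4]
      · rw [if_neg hx, h2]
        have : x < i ↔ x < i + 1 := by omega
        simp only [this]
    · rw [Prog.exec]
      refine ⟨hc, h1.set (by simp) _ _, fun x => ?_⟩
      rw [Mem.set_ne _ _ (by decide), h2]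
      by_cases hx : x = i
      · subst hx; simp [h4]
      · have : x < i ↔ x < i + 1 := by omega
        simp only [this]
  · rintro σ' ⟨h1, h2⟩
    have h3 : ∀ x < a 0, σ' 3 x = if σ 4 x = 0 then σ 3 x + 1 else σ 3 x := by
      intro x hx; simp [h2, hx]
    refine ⟨h1, fun j hj => ?_, h3⟩
    rw [h3 _ (hr j hj).1, h3 _ (hr j hj).2]
    obtain ⟨g1, g2⟩ := hs j hj
    constructor
    · intro hf
      have := g1 hf
      have := fun ht hx => hcl j _ _ ⟨hj, ht, .inr ⟨hf, rfl, rfl⟩⟩ hx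
      split_ifs <;> omega
    · intro hf
      have := g2 hf
      have := fun ht hx => hcl j _ _ ⟨hj, ht, .inl ⟨hf, rfl, rfl⟩⟩ hx
      split_ifs <;> omega

end Search

end DSNProgram

/-! ### Decoding the input and the edge sets stored as flags. -/

namespace DSNInstance

variable (I : DSNInstance)

theorem length_encodeEdges {n : ℕ} (L : List (Fin n × Fin n)) :
    (encodeEdges L).length = L.length + L.length := by
  induction L with
  | nil => rfl
  | cons e L ih =>
    have : encodeEdges (e :: L) = (e.1 : ℕ) :: (e.2 : ℕ) :: encodeEdges L := rfl
    rw [this]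
    simp only [List.length_cons, ih]
    omega

theorem getD_encodeEdges_append {n : ℕ} (L : List (Fin n × Fin n)) (r : List ℕ) {j : ℕ}
    (hj : j < L.length) : (encodeEdges L ++ r).getD (j + j) 0 = (L[j].1 : ℕ) ∧
      (encodeEdges L ++ r).getD (j + j + 1) 0 = (L[j].2 : ℕ) := by
  induction L generalizing j with
  | nil => simp at hj
  | cons e L ih =>
    have : encodeEdges (e :: L) ++ r = (e.1 : ℕ) :: (e.2 : ℕ) :: (encodeEdges L ++ r) := rfl
    rw [this]
    cases j with
    | zero => simp
    | succ j =>
      have h := ih (j := j) (by simpa using hj)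
      rw [show j + 1 + (j + 1) = j + j + 1 + 1 by ring]
      simpa only [List.getD_cons_succ, List.getElem_cons_succ] using h

theorem getD_flatMap_demands {n : ℕ} (L : List ((Fin n × Fin n) × ℕ)) {j : ℕ}
    (hj : j < L.length) :
    (L.flatMap fun q => [(q.1.1 : ℕ), (q.1.2 : ℕ), q.2]).getD (j + (j + j)) 0 = (L[j].1.1 : ℕ) ∧
    (L.flatMap fun q => [(q.1.1 : ℕ), (q.1.2 : ℕ), q.2]).getD (j + (j + j) + 1) 0 =
      (L[j].1.2 : ℕ) ∧
    (L.flatMap fun q => [(q.1.1 : ℕ), (q.1.2 : ℕ), q.2]).getD (j + (j + j) + 2) 0 = L[j].2 := by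
  induction L generalizing j with
  | nil => simp at hj
  | cons e L ih =>
    have : (e :: L).flatMap (fun q => [(q.1.1 : ℕ), (q.1.2 : ℕ), q.2]) =
        (e.1.1 : ℕ) :: (e.1.2 : ℕ) :: e.2 ::
          L.flatMap fun q => [(q.1.1 : ℕ), (q.1.2 : ℕ), q.2] := rfl
    rw [this]
    cases j with
    | zero => simp
    | succ j =>
      have h := ih (j := j) (by simpa using hj)
      rw [show j + 1 + (j + 1 + (j + 1)) = j + (j + j) + 1 + 1 + 1 by ring]
      simpa only [List.getD_cons_succ, List.getElem_cons_succ] using h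

/-- The content of the input bank. -/
def input (i : ℕ) : ℕ := I.encode.getD i 0

theorem encode_eq : I.encode = I.n :: I.edges.length :: (encodeEdges I.edges ++
    (I.demands.length :: I.demands.flatMap fun q => [(q.1.1 : ℕ), (q.1.2 : ℕ), q.2])) := by
  simp [encode]

@[simp] theorem input_zero : I.input 0 = I.n := by simp [input, encode_eq]

@[simp] theorem input_one : I.input 1 = I.edges.length := by simp [input, encode_eq]

theorem input_src {j : ℕ} (hj : j < I.edges.length) :
    I.input (2 + (j + j)) = (I.edges[j].1 : ℕ) := by
  rw [input, encode_eq, add_comm]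
  simp only [List.getD_cons_succ]
  exact (getD_encodeEdges_append _ _ hj).1

theorem input_dst {j : ℕ} (hj : j < I.edges.length) :
    I.input (3 + (j + j)) = (I.edges[j].2 : ℕ) := by
  rw [input, encode_eq, show 3 + (j + j) = j + j + 1 + 1 + 1 by ring]
  simp only [List.getD_cons_succ]
  exact (getD_encodeEdges_append _ _ hj).2

theorem input_tail (i : ℕ) : I.input (2 + (I.edges.length + I.edges.length) + i) =
    (I.demands.length :: I.demands.flatMap
      fun q => [(q.1.1 : ℕ), (q.1.2 : ℕ), q.2]).getD i 0 := by
  rw [input, encode_eq,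
    show 2 + (I.edges.length + I.edges.length) + i = (encodeEdges I.edges).length + i + 1 + 1 by
      rw [length_encodeEdges]; ring]
  simp only [List.getD_cons_succ]
  rw [List.getD_append_right _ _ _ _ (by omega), Nat.add_sub_cancel_left]

theorem input_numDemands : I.input (2 + (I.edges.length + I.edges.length)) = I.demands.length := by
  simpa using I.input_tail 0

theorem input_demand {i : ℕ} (hi : i < I.demands.length) :
    I.input (3 + ((I.edges.length + I.edges.length) + (i + (i + i)))) =
      (I.demands[i].1.1 : ℕ) ∧
    I.input (4 + ((I.edges.length + I.edges.length) + (i + (i + i)))) =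
      (I.demands[i].1.2 : ℕ) ∧
    I.input (5 + ((I.edges.length + I.edges.length) + (i + (i + i)))) = I.demands[i].2 := by
  obtain ⟨h1, h2, h3⟩ := getD_flatMap_demands I.demands hi
  refine ⟨?_, ?_, ?_⟩
  · rw [← h1, show 3 + ((I.edges.length + I.edges.length) + (i + (i + i))) =
      2 + (I.edges.length + I.edges.length) + (i + (i + i) + 1) by ring, input_tail,
      List.getD_cons_succ]
  · rw [← h2, show 4 + ((I.edges.length + I.edges.length) + (i + (i + i))) =
      2 + (I.edges.length + I.edges.length) + (i + (i + i) + 1 + 1) by ring, input_tail,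
      List.getD_cons_succ]
  · rw [← h3, show 5 + ((I.edges.length + I.edges.length) + (i + (i + i))) =
      2 + (I.edges.length + I.edges.length) + (i + (i + i) + 2 + 1) by ring, input_tail,
      List.getD_cons_succ]

theorem edgesInRange : DSNProgram.EdgesInRange I.input := by
  intro j hj
  rw [input_one] at hj
  simp only [DSNProgram.src, DSNProgram.dst, I.input_src hj, I.input_dst hj, input_zero]
  exact ⟨Fin.isLt _, Fin.isLt _⟩

/-- The set of the edges whose flag is nonzero. -/
def flagSet (f : ℕ → ℕ) : Finset (Fin I.n × Fin I.n) :=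
  I.edges.toFinset.filter fun e => f (I.edges.idxOf e) ≠ 0

theorem flagSet_subset (f : ℕ → ℕ) : I.flagSet f ⊆ I.edges.toFinset := Finset.filter_subset _ _

variable {I}

theorem getElem_mem_flagSet {f : ℕ → ℕ} {j : ℕ} (hj : j < I.edges.length) :
    I.edges[j] ∈ I.flagSet f ↔ f j ≠ 0 := by
  simp [flagSet, I.edges_nodup.idxOf_getElem]

theorem mem_flagSet_iff {f : ℕ → ℕ} {e : Fin I.n × Fin I.n} :
    e ∈ I.flagSet f ↔ ∃ (j : ℕ) (h : j < I.edges.length), I.edges[j] = e ∧ f j ≠ 0 := by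
  constructor
  · intro he
    obtain ⟨j, hj, rfl⟩ := List.getElem_of_mem (List.mem_toFinset.1 (I.flagSet_subset f he))
    exact ⟨j, hj, rfl, (getElem_mem_flagSet hj).1 he⟩
  · rintro ⟨j, hj, rfl, hf⟩
    exact (getElem_mem_flagSet hj).2 hf

theorem flagSet_update_zero {f : ℕ → ℕ} {j : ℕ} (hj : j < I.edges.length) :
    I.flagSet (Function.update f j 0) = (I.flagSet f).erase I.edges[j] := by
  ext e
  by_cases he : e ∈ I.edges
  · obtain ⟨i, hi, rfl⟩ := List.getElem_of_mem he
    rw [Finset.mem_erase, getElem_mem_flagSet hi, getElem_mem_flagSet hi,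
      Function.update_apply, ne_eq, ne_eq, I.edges_nodup.getElem_inj_iff]
    split_ifs <;> simp_all
  · have h : ∀ g, e ∉ I.flagSet g := fun g hg => he (List.mem_toFinset.1 (I.flagSet_subset g hg))
    simp [h]

theorem flagSet_update_one {f : ℕ → ℕ} {j : ℕ} (hj : j < I.edges.length) :
    I.flagSet (Function.update f j 1) = insert I.edges[j] (I.flagSet f) := by
  ext e
  by_cases he : e ∈ I.edges
  · obtain ⟨i, hi, rfl⟩ := List.getElem_of_mem he
    rw [Finset.mem_insert, getElem_mem_flagSet hi, getElem_mem_flagSet hi,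
      Function.update_apply, I.edges_nodup.getElem_inj_iff]
    split_ifs <;> simp_all
  · have h : ∀ g, e ∉ I.flagSet g := fun g hg => he (List.mem_toFinset.1 (I.flagSet_subset g hg))
    have h' : e ≠ I.edges[j] := by rintro rfl; exact he (List.getElem_mem _)
    simp [h, h']

theorem isSlack_flagSet {f π : ℕ → ℕ} (h : DSNProgram.Slack I.input f π) :
    IsSlack I.edges.toFinset (I.flagSet f) fun x => π x := by
  intro e he
  obtain ⟨j, hj, rfl⟩ := List.getElem_of_mem (List.mem_toFinset.1 he)
  have := h j (by simpa using hj)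
  simp only [DSNProgram.src, DSNProgram.dst, I.input_src hj, I.input_dst hj] at this
  rw [getElem_mem_flagSet hj]
  exact ⟨this.1, fun h => this.2 (not_not.1 h)⟩

end DSNInstance

/-! ### Augmentation, phases and the treatment of one terminal pair. -/

namespace DSNProgram

open RAM DSNInstance

variable {I : DSNInstance}

/-- The banks that are changed while one terminal pair is treated. -/
abbrev work : List ℕ := [2, 3, 4, 5, 8, 9, 10, 11, 12, 13]

theorem eval_demE {σ : Mem} {i : ℕ} (ha : σ 0 = I.input) (hi : σ 7 0 = i)
    (h : i < I.demands.length) : (demE 3).eval σ = (I.demands[i].1.1 : ℕ) ∧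
      (demE 4).eval σ = (I.demands[i].1.2 : ℕ) ∧ (demE 5).eval σ = I.demands[i].2 := by
  simpa only [Expr.eval, ha, hi, input_one] using I.input_demand h

/-- A tight edge satisfies both slackness inequalities, so its flag may be changed freely. -/
theorem Slack.update {a f π : ℕ → ℕ} {j c : ℕ} (h : Slack a f π)
    (ht : π (dst a j) = π (src a j) + 1) : Slack a (Function.update f j c) π := by
  intro i hi
  by_cases hij : i = j
  · subst hij; omega
  · rw [Function.update_of_ne hij]; exact h i hi

/-- Toggling the edge `j` moves the end of the flow along the residual edge from `y` to `x`. -/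
theorem netOut_toggle {f g π : ℕ → ℕ} {j x y : ℕ} (h : Arc I.input f π j y x)
    (hg : g j = f j) (z : Fin I.n) :
    netOut (I.flagSet (Function.update g j (if g j = 0 then 1 else 0))) z =
      netOut (I.flagSet g) z +
        ((if (z : ℕ) = y then 1 else 0) - (if (z : ℕ) = x then 1 else 0)) := by
  obtain ⟨hj, -, h⟩ := h
  rw [input_one] at hj
  simp only [src, dst, I.input_src hj, I.input_dst hj] at h
  rcases h with ⟨hf, rfl, rfl⟩ | ⟨hf, rfl, rfl⟩
  · rw [if_pos (by omega), flagSet_update_one hj,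
      netOut_insert (by rw [getElem_mem_flagSet hj]; omega)]
    simp only [Fin.ext_iff, eq_comm (b := (z : ℕ))]
    ring
  · rw [if_neg (by omega), flagSet_update_zero hj,
      netOut_erase (by rw [getElem_mem_flagSet hj]; omega)]
    simp only [Fin.ext_iff, eq_comm (b := (z : ℕ))]
    ring

theorem exec_backStep {σ : Mem} :
    backStep.exec σ = ((σ.set 10 0 (σ 5 (σ 12 0))).set 2 (σ 5 (σ 12 0))
      (if σ 2 (σ 5 (σ 12 0)) = 0 then 1 else 0)).set 12 0
        (if σ 2 (σ 5 (σ 12 0)) = 0 then src (σ 0) (σ 5 (σ 12 0)) else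
          dst (σ 0) (σ 5 (σ 12 0))) := by
  have he : (Expr.read 2 (var 10)).eval ((Prog.assign 10 (.read 5 (var 12))).exec σ) =
      σ 2 (σ 5 (σ 12 0)) := by simp [Prog.exec, Expr.eval, Mem.set_ne]
  rw [backStep, Prog.exec]
  by_cases h : σ 2 (σ 5 (σ 12 0)) = 0
  · rw [Prog.exec_ite_of_eq_zero _ _ (he.trans h), if_pos h, if_pos h]
    simp [Prog.exec, Expr.eval, Mem.set_ne]
  · rw [Prog.exec_ite_of_ne_zero _ _ (he.trans_ne h), if_neg h, if_neg h]
    simp [Prog.exec, Expr.eval, Mem.set_ne]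

theorem wp_augment {σ : Mem} {s t : Fin I.n} {B : ℕ} (ha : σ 0 = I.input)
    (hs : Slack I.input (σ 2) (σ 3)) (hes : (demE 3).eval σ = s) (het : (demE 4).eval σ = t)
    (htree : IsTree I.input (σ 2) (σ 3) s B (σ 4) (σ 5)) (ht : σ 4 t ≠ 0)
    (hflow : IsFlow (I.flagSet (σ 2)) s t (σ 11 0)) :
    Wp augment ((B + 1) * 200 + 100) (fun σ' => SameOff [2, 10, 11, 12] σ σ' ∧
      Slack I.input (σ' 2) (σ 3) ∧ σ' 11 0 = σ 11 0 + 1 ∧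
      IsFlow (I.flagSet (σ' 2)) s t (σ 11 0 + 1)) σ := by
  have h1 : Wp (.assign 12 (demE 4)) 50 (fun σ' => σ' = σ.set 12 0 t) σ :=
    Wp.of_loopFree rfl (by decide) (by simp only [Prog.exec, het]; rfl)
  refine (h1.seq (T' := (B + 1) * 200 + 50) ?_).mono (by omega) fun _ h => h
  rintro _ rfl
  have hdem : ∀ σ', SameOff [2, 10, 12] σ σ' → (demE 3).eval σ' = s := fun σ' h => by
    rw [← hes]; simp only [Expr.eval, h 0 (by decide), h 7 (by decide)]
  refine Wp.mono (T := (B + 1) * 200 + 20) (Wp.seq (R := fun σ' => SameOff [2, 10, 12] σ σ' ∧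
    Slack I.input (σ' 2) (σ 3) ∧ IsFlow (I.flagSet (σ' 2)) s t (σ 11 0 + 1)) ?_ ?_)
    (by omega) fun _ h => h
  -- With `x` the current vertex, the flags represent the old flow plus one unit from `x` to `t`.
  -- Edges with both endpoints at level at most that of `x` are untouched. The level of `x` is the
  -- variant.
  · refine (Wp.loop (T := 100) (fun σ' => SameOff [2, 10, 12] σ σ' ∧
      Slack I.input (σ' 2) (σ 3) ∧ σ' 12 0 < I.n ∧ σ 4 (σ' 12 0) ≠ 0 ∧
      (∀ j < I.edges.length, σ 4 (src I.input j) ≤ σ 4 (σ' 12 0) →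
        σ 4 (dst I.input j) ≤ σ 4 (σ' 12 0) → σ' 2 j = σ 2 j) ∧
      ∀ z : Fin I.n, netOut (I.flagSet (σ' 2)) z =
        (if z = s then (σ 11 0 : ℤ) else 0) - (if z = t then (σ 11 0 : ℤ) else 0) +
          ((if (z : ℕ) = σ' 12 0 then 1 else 0) - (if z = t then 1 else 0)))
      (fun σ' => σ 4 (σ' 12 0)) ?_ ?_ B _ ?_ ?_).mono ?_ fun _ h => h
    · rintro σ' ⟨g1, g2, g3, g4, g5, g6⟩ he
      have hxs : σ' 12 0 ≠ s := by
        rintro h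
        apply he
        have := hdem σ' g1
        simp only [Expr.eval] at this ⊢
        omega
      obtain ⟨-, hp⟩ := htree.2 (σ' 12 0) (by simpa using g3) g4
      obtain ⟨y, harc, hy, hlt⟩ := hp.resolve_left hxs
      refine Wp.of_loopFree rfl (by decide) ?_
      have hj : σ 5 (σ' 12 0) < I.edges.length := by simpa using harc.1
      -- The parent edge lies in the untouched range, so its flag is the one seen by the search. One
      -- endpoint has the level of `x`, so the edge drops out of the range after the move to the
      -- lower vertex `y`.
      have hend : σ 4 (src I.input (σ 5 (σ' 12 0))) ≤ σ 4 (σ' 12 0) ∧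
          σ 4 (dst I.input (σ 5 (σ' 12 0))) ≤ σ 4 (σ' 12 0) ∧
          (σ 4 (src I.input (σ 5 (σ' 12 0))) = σ 4 (σ' 12 0) ∨
            σ 4 (dst I.input (σ 5 (σ' 12 0))) = σ 4 (σ' 12 0)) := by
        rcases harc.2.2 with ⟨-, e1, e2⟩ | ⟨-, e1, e2⟩ <;> rw [← e1, ← e2] <;>
          exact ⟨by omega, by omega, by simp⟩
      have hfj := g5 _ hj hend.1 hend.2.1
      have hyx : (if σ' 2 (σ 5 (σ' 12 0)) = 0 then src I.input (σ 5 (σ' 12 0)) else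
          dst I.input (σ 5 (σ' 12 0))) = y := by
        rw [hfj]
        rcases harc.2.2 with ⟨h0, e1, -⟩ | ⟨h0, e1, -⟩
        · rw [if_pos h0, e1]
        · rw [if_neg h0, e1]
      rw [exec_backStep, g1 0 (by decide), g1 5 (by decide), ha, hyx]
      simp only [Mem.set_same, Mem.set_ne (b := 12) (b' := 2) _ _ (by decide),
        Mem.set_ne (b := 10) (b' := 2) _ _ (by decide), Function.update_self]
      refine ⟨⟨((g1.set (by simp) _ _).set (by simp) _ _).set (by simp) _ _, g2.update harc.2.1,
        by simpa using (harc.lt I.edgesInRange).1, hy, ?_, ?_⟩, hlt⟩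
      · intro i hi hi1 hi2
        have hij : i ≠ σ 5 (σ' 12 0) := by
          rintro rfl
          omega
        rw [Function.update_of_ne hij]
        exact g5 i hi (by omega) (by omega)
      · intro z
        rw [netOut_toggle harc hfj, g6 z]
        ring
    · rintro σ' ⟨g1, g2, g3, g4, g5, g6⟩ he
      have hxs : σ' 12 0 = s := by
        have := hdem σ' g1
        simp only [Expr.eval] at this he
        omega
      refine ⟨g1, g2, fun z => ?_⟩
      rw [g6 z, hxs]
      simp only [← Fin.ext_iff]
      push_cast
      split_ifs <;> ring
    · simpa using (htree.2 t (by simp) ht).1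
    · refine ⟨(SameOff.refl _ _).set (by simp) _ _, ?_⟩
      simp only [Mem.set_same, Mem.set_ne (b := 12) (b' := 2) _ _ (by decide), Function.update_self]
      refine ⟨hs, t.isLt, ht, fun _ _ _ _ => True.intro, fun z => ?_⟩
      rw [hflow z]
      simp only [← Fin.ext_iff]
      ring
    · exact Nat.mul_le_mul_left _ (by decide)
  · rintro σ' ⟨g1, g2, g3⟩
    refine Wp.of_loopFree rfl (by decide) ?_
    simp only [Prog.exec, Expr.eval, Mem.set_same, Mem.set_ne (b := 11) (b' := 2) _ _ (by decide),
      Function.update_self, g1 11 (by decide)]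
    exact ⟨(g1.trans (SameOff.refl _ _) (by simp)).set (by simp) _ _, g2, True.intro, g3⟩

/-- The invariant of the augmentation phases, where `it` phases have been executed since the
memory `σ₀`. -/
def PhaseInv (I : DSNInstance) (s t : Fin I.n) (d : ℕ) (σ₀ : Mem) (it : ℕ) (σ : Mem) : Prop :=
  SameOff work σ₀ σ ∧ Slack I.input (σ 2) (σ 3) ∧ IsFlow (I.flagSet (σ 2)) s t (σ 11 0) ∧
    σ 3 s = 0 ∧ σ 11 0 ≤ d ∧ (σ 11 0 < d → σ 11 0 + σ 3 t = it)

/-- A bound for the number of steps of a phase. -/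
def phaseTime (n m : ℕ) : ℕ :=
  (n + 1) * ((m + 1) * 220 + 20) + 3 + 100 + ((n + 1) * 20 + 3) +
    ((1 + n * m + 1) * 200 + (n + 1) * 40 + 200)

theorem wp_phase {σ₀ σ : Mem} {i it : ℕ} (ha : σ₀ 0 = I.input) (hi : σ₀ 7 0 = i)
    (hk : i < I.demands.length)
    (hinv : PhaseInv I I.demands[i].1.1 I.demands[i].1.2 I.demands[i].2 σ₀ it σ) :
    Wp phase (phaseTime I.n I.edges.length + 100)
      (fun σ' => PhaseInv I I.demands[i].1.1 I.demands[i].1.2 I.demands[i].2 σ₀ (it + 1) σ' ∧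
        σ' 8 = σ 8) σ := by
  obtain ⟨h1, h2, h3, h4, h5, h6⟩ := hinv
  have e0 : ∀ {σ'}, SameOff work σ₀ σ' → σ' 0 = I.input := fun h => by rw [h 0 (by decide), ha]
  have dem : ∀ {σ'}, SameOff work σ₀ σ' → _ := fun h =>
    eval_demE (e0 h) (by rw [h 7 (by decide), hi]) hk
  refine Wp.mono (T := _ + 1 + phaseTime I.n I.edges.length) (Wp.ite ?_ ?_) ?_ fun _ h => h
  · intro he
    have hlt : σ 11 0 < I.demands[i].2 := by
      have h := (dem h1).2.2
      simp only [Expr.eval] at h he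
      omega
    have hS := wp_search (s := (I.demands[i].1.1 : ℕ)) I.edgesInRange (e0 h1) h2 (dem h1).1
      (by simp)
    rw [input_zero, input_one] at hS
    refine hS.seq ?_
    rintro σ₁ ⟨g1, g2, g3⟩
    have g0 := h1.trans (g1.trans (S' := work) (SameOff.refl _ _) (by decide)) (by decide)
    have c2 := g1 2 (by decide)
    have c3 := g1 3 (by decide)
    have c11 := g1 11 (by decide)
    refine Wp.mono (T := _ + 1 + ((1 + I.n * I.edges.length + 1) * 200 + 100 + (I.n + 1) * 40 + 3))
      (Wp.ite ?_ ?_) ?_ fun _ h => h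
    · intro ht
      have hA := wp_augment (s := I.demands[i].1.1) (t := I.demands[i].1.2) (e0 g0)
        (by rwa [c2, c3]) (dem g0).1 (dem g0).2.1 (by rw [c2, c3]; exact g2)
        (by rw [← (dem g0).2.1]; exact ht) (by rwa [c2, c11])
      refine hA.mono (by omega) ?_
      rintro σ₂ ⟨k1, k2, k3, k4⟩
      have d3 := k1 3 (by decide)
      refine ⟨⟨g0.trans (k1.trans (S' := work) (SameOff.refl _ _) (by decide)) (by decide),
        by rwa [d3], by rwa [k3], by rw [d3, c3, h4], by rw [k3, c11]; exact hlt, fun _ => ?_⟩,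
        by rw [k1 8 (by decide), g1 8 (by decide)]⟩
      rw [d3, c3, k3, c11]
      have := h6 hlt
      omega
    · intro ht
      have hR := wp_raise I.edgesInRange (e0 g0) (by rwa [c2, c3]) (by rw [c2, c3]; exact g3)
      rw [input_zero] at hR
      refine hR.mono (by omega) ?_
      rintro σ₂ ⟨k1, k2, k3⟩
      have d2 := k1 2 (by decide)
      have d11 := k1 11 (by decide)
      have ht' : σ₁ 4 (I.demands[i].1.2 : ℕ) = 0 := by rw [← (dem g0).2.1]; exact ht
      refine ⟨⟨g0.trans (k1.trans (S' := work) (SameOff.refl _ _) (by decide)) (by decide),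
        by rwa [d2], by rwa [d2, d11, c2, c11], ?_, by rwa [d11, c11], fun _ => ?_⟩,
        by rw [k1 8 (by decide), g1 8 (by decide)]⟩
      · rw [k3 _ (by simp), if_neg g2.1, c3, h4]
      · rw [k3 _ (by simp), if_pos ht', c3, d11, c11]
        have := h6 hlt
        omega
    · simp only [Expr.cost]; omega
  -- The demand is met, so the clause that counts phases is vacuous.
  · intro he
    refine Wp.of_loopFree rfl (by simp only [Prog.maxCost, phaseTime]; omega) ?_
    refine ⟨⟨h1, h2, h3, h4, h5, fun hlt => ?_⟩, rfl⟩
    change σ 11 0 < _ at hlt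
    have h := (dem h1).2.2
    simp only [Expr.eval] at h he
    omega
  · simp only [Expr.cost]; omega

/-- A bound for the number of steps for one terminal pair. -/
def pairTime (n m : ℕ) : ℕ :=
  (m + 1) * 20 + (n + 1) * 20 + 100 + (2 * m + 2) * (phaseTime n m + 120) + (m + 1) * 50

/-- The witness `f` holds the flags of the final flow. Bank `6` accumulates by addition, so a
nonzero entry marks membership in the union. -/
theorem wp_treatPair {σ : Mem} {i : ℕ} (ha : σ 0 = I.input) (hi : σ 7 0 = i)
    (hk : i < I.demands.length) :
    Wp treatPair (pairTime I.n I.edges.length) (fun σ' => SameOff (6 :: work) σ σ' ∧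
      ∃ f : ℕ → ℕ, (∀ j < I.edges.length, σ' 6 j = σ 6 j + f j) ∧
        (HasDisjointPaths I.edges.toFinset I.demands[i].1.1 I.demands[i].1.2 I.demands[i].2 →
          I.IsMinEdgeSet I.demands[i].1.1 I.demands[i].1.2 I.demands[i].2 (I.flagSet f))) σ := by
  have h1 := wp_clear (c := 10) (b := 2) (N := I.edges.length) (e := mE) (by decide) σ
    fun σ' h => by simp [Expr.eval, h 0 (by decide), ha]
  refine (h1.seq (T' := (I.n + 1) * 20 + 90 +
    (2 * I.edges.length + 2) * (phaseTime I.n I.edges.length + 120) + (I.edges.length + 1) * 50)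
    fun σ₁ ⟨g1, g2⟩ => ?_).mono
    (by simp only [Expr.cost, pairTime]; omega) fun σ' h => h
  have h2 := wp_clear (c := 13) (b := 3) (N := I.n) (e := nE) (by decide) σ₁
    fun σ' h => by simp [Expr.eval, h 0 (by decide), g1 0 (by decide), ha]
  refine (h2.seq (T' := 80 +
    (2 * I.edges.length + 2) * (phaseTime I.n I.edges.length + 120) + (I.edges.length + 1) * 50)
    fun σ₂ ⟨k1, k2⟩ => ?_).mono
    (by simp only [Expr.cost]; omega) fun σ' h => h
  have h3 : Wp (.assign 11 (.const 0)) 3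
      (PhaseInv I I.demands[i].1.1 I.demands[i].1.2 I.demands[i].2 σ 0) σ₂ := by
    refine Wp.of_loopFree rfl (by decide) ?_
    have hf : ∀ j < I.edges.length, σ₂ 2 j = 0 := fun j hj => by
      rw [k1 2 (by decide), g2 j hj]
    have hempty : I.flagSet (σ₂ 2) = ∅ := by
      refine Finset.eq_empty_of_forall_notMem fun e he => ?_
      obtain ⟨j, hj, -, h⟩ := mem_flagSet_iff.1 he
      exact h (hf j hj)
    simp only [Prog.exec, Expr.eval, PhaseInv, Mem.set_same, Function.update_self,
      Mem.set_ne (b := 11) (b' := 2) _ _ (by decide),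
      Mem.set_ne (b := 11) (b' := 3) _ _ (by decide)]
    refine ⟨((g1.trans (S' := work) (SameOff.refl _ _) (by decide)).trans
      (k1.trans (S' := work) (SameOff.refl _ _) (by decide)) (by decide)).set (by decide) _ _,
      -- The empty flow and the zero potential are in slackness because every edge has cost one.
      fun j hj => ?_, ?_, k2 _ (Fin.isLt _), Nat.zero_le _, fun _ => ?_⟩
    · obtain ⟨r1, r2⟩ := I.edgesInRange j hj
      rw [input_zero] at r1 r2
      rw [k2 _ r1, k2 _ r2, hf j (by simpa using hj)]
      simp
    · rw [hempty]; exact isFlow_empty _ _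
    · simp [k2]
  refine (h3.seq (T' := 70 +
    (2 * I.edges.length + 2) * (phaseTime I.n I.edges.length + 120) + (I.edges.length + 1) * 50)
    fun σ₃ k3 => ?_).mono (by omega) fun σ' h => h
  have h4 : Wp (.forLoop 8 (.add (.add mE mE) (.const 1)) phase)
      ((2 * I.edges.length + 2) * (phaseTime I.n I.edges.length + 120) + 3)
      (PhaseInv I I.demands[i].1.1 I.demands[i].1.2 I.demands[i].2 σ
        (2 * I.edges.length + 1)) σ₃ := by
    have hset : ∀ it σ' v, PhaseInv I I.demands[i].1.1 I.demands[i].1.2 I.demands[i].2 σ it σ' →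
        PhaseInv I I.demands[i].1.1 I.demands[i].1.2 I.demands[i].2 σ it (σ'.set 8 0 v) := by
      rintro it σ' v ⟨p1, p⟩
      refine ⟨p1.set (by decide) _ _, ?_⟩
      simpa [Mem.set_ne] using p
    refine (Wp.forLoop (T := phaseTime I.n I.edges.length + 100) (N := 2 * I.edges.length + 1)
      (PhaseInv I I.demands[i].1.1 I.demands[i].1.2 I.demands[i].2 σ)
      (hset _ _ _ k3) ?_ ?_ fun _ h => h).mono ?_ fun _ h => h
    · rintro it σ' ⟨p, -⟩
      simp [Expr.eval, p 0 (by decide), ha, two_mul]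
    · intro it σ' _ hc hp
      refine (wp_phase ha hi hk hp).mono le_rfl ?_
      rintro σ'' ⟨hp', h8⟩
      exact ⟨by rw [h8, hc], hset _ _ _ hp'⟩
    · simp only [Expr.cost]
      exact Nat.add_le_add_right (Nat.mul_le_mul_left _ (by omega)) _
  refine (h4.seq (T' := (I.edges.length + 1) * 50 + 3) ?_).mono (by omega) fun _ h => h
  rintro σ₄ ⟨p1, p2, p3, p4, p5, p6⟩
  refine (Wp.forLoop (T := 30) (N := I.edges.length) (fun j σ' => SameOff (6 :: work) σ σ' ∧
    σ' 2 = σ₄ 2 ∧ ∀ l, σ' 6 l = if l < j then σ 6 l + σ₄ 2 l else σ 6 l)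
    ?_ ?_ ?_ ?_).mono ?_ fun _ h => h
  · refine ⟨(p1.trans (SameOff.refl _ _) (by decide)).set (by decide) _ _, ?_, fun l => ?_⟩
    · rw [Mem.set_ne _ _ (by decide)]
    · rw [Mem.set_ne _ _ (by decide), p1 6 (by decide)]; simp
  · rintro j σ' ⟨h, -⟩
    simp [Expr.eval, h 0 (by decide), ha]
  · rintro j σ' hj hc ⟨q1, q2, q3⟩
    refine Wp.of_loopFree rfl (by decide) ?_
    simp only [Prog.exec, Expr.eval, hc]
    refine ⟨by rw [Mem.set_ne _ _ (by decide), hc], (q1.set (by decide) _ _).set (by decide) _ _,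
      by rw [Mem.set_ne _ _ (by decide), Mem.set_ne _ _ (by decide), q2], fun l => ?_⟩
    rw [Mem.set_ne _ _ (by decide), Mem.set_same, Function.update_apply, q2]
    by_cases hl : l = j
    · subst hl; simp [q3]
    · have : l < j ↔ l < j + 1 := by omega
      rw [if_neg hl, q3]
      simp only [this]
  · rintro σ' ⟨q1, q2, q3⟩
    refine ⟨q1, σ₄ 2, fun j hj => by rw [q3, if_pos hj], fun hP => ⟨I.flagSet_subset _, ?_⟩⟩
    refine (isSlack_flagSet p2).min_of_le (I.flagSet_subset _) p3 p4 p5 (fun h => ?_) hP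
    rw [p6 h, List.toFinset_card_of_nodup I.edges_nodup]
  · simp only [Expr.cost]
    exact Nat.add_le_add_right (Nat.mul_le_mul_left _ (by omega)) _

/-! ### Output and the whole algorithm. -/

theorem encodeEdges_append {n : ℕ} (L L' : List (Fin n × Fin n)) :
    encodeEdges (L ++ L') = encodeEdges L ++ encodeEdges L' := List.flatMap_append

/-- Cell `0` of bank `1` is both the output length and the write position, so after each round the
bank holds a valid output for the edges scanned so far. -/
theorem wp_emit {σ : Mem} (ha : σ 0 = I.input) (hout : σ 1 0 = 0) :
    Wp emit ((I.edges.length + 1) * 100 + 3) (fun σ' => HoldsOutput σ'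
      (encodeEdges (I.edges.filter fun e => e ∈ I.flagSet (σ 6)))) σ := by
  refine (Wp.forLoop (T := 80) (N := I.edges.length) (fun j σ' => SameOff [1, 10] σ σ' ∧
    HoldsOutput σ' (encodeEdges ((I.edges.take j).filter fun e => e ∈ I.flagSet (σ 6))))
    ?_ ?_ ?_ ?_).mono ?_ fun _ h => h
  · refine ⟨(SameOff.refl _ _).set (by decide) _ _, ?_⟩
    simp [HoldsOutput, encodeEdges, Mem.set_ne, hout]
  · rintro j σ' ⟨h, -⟩
    simp [Expr.eval, h 0 (by decide), ha]
  · rintro j σ' hj hc ⟨q1, q2, q3⟩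
    refine Wp.of_loopFree rfl (by decide) ?_
    have he : (Expr.read 6 (var 10)).eval σ' = σ 6 j := by simp [Expr.eval, hc, q1 6 (by decide)]
    rw [List.take_succ_eq_append_getElem hj, List.filter_append, encodeEdges_append]
    by_cases h : σ 6 j = 0
    · rw [Prog.exec_ite_of_eq_zero _ _ (he.trans h), List.filter_cons_of_neg
        (by simpa [getElem_mem_flagSet hj] using h)]
      refine ⟨hc, q1.set (by decide) _ _, ?_⟩
      change HoldsOutput _ (_ ++ [])
      rw [List.append_nil, HoldsOutput, Prog.exec, Mem.set_ne _ _ (by decide)]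
      exact ⟨q2, q3⟩
    · rw [Prog.exec_ite_of_ne_zero _ _ (he.trans_ne h), List.filter_cons_of_pos
        (by simpa [getElem_mem_flagSet hj] using h)]
      have hs := I.input_src hj
      have hd := I.input_dst hj
      simp only [Prog.exec, Expr.eval, hc, Mem.set_same, q1 0 (by decide), ha, hs, hd,
        Mem.set_ne (b := 1) (b' := 0) _ _ (by decide),
        Mem.set_ne (b := 1) (b' := 10) _ _ (by decide)]
      refine ⟨True.intro, ((((q1.set (by decide) _ _).set (by decide) _ _).set
        (by decide) _ _).set (by decide) _ _), ?_⟩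
      generalize encodeEdges ((I.edges.take j).filter fun e => e ∈ I.flagSet (σ 6)) = y at *
      simp only [HoldsOutput, Mem.set_ne (b := 10) (b' := 1) _ _ (by decide), Mem.set_same,
        Function.update_apply, List.length_append, q2]
      have hy : encodeEdges [I.edges[j]] = [(I.edges[j].1 : ℕ), (I.edges[j].2 : ℕ)] := rfl
      simp only [List.filter_nil, hy]
      refine ⟨by simp, fun i hi => ?_⟩
      simp at hi
      rcases lt_trichotomy i y.length with hlt | rfl | hgt
      · rw [List.getD_append _ _ _ _ hlt, ← q3 i hlt]
        have h1 : i + 1 ≠ y.length + 2 := by omega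
        have h2 : i + 1 ≠ y.length + 1 := by omega
        have h3 : i + 1 ≠ 0 := by omega
        have h4 : 0 ≠ y.length + 1 := by omega
        simp only [h1, h2, h3, h4, if_false]
      · rw [List.getD_append_right _ _ _ _ le_rfl]
        simp
      · obtain rfl : i = y.length + 1 := by omega
        rw [List.getD_append_right _ _ _ _ (by omega)]
        simp
  · rintro σ' ⟨-, h⟩
    simpa using h
  · simp only [Expr.cost]
    exact Nat.add_le_add_right (Nat.mul_le_mul_left _ (by omega)) _

/-- A bound for the number of steps of the algorithm. -/
def mainTime (n m k : ℕ) : ℕ :=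
  (k + 1) * (pairTime n m + 100) + 3 + ((m + 1) * 100 + 3)

theorem wp_main (I : DSNInstance) :
    Wp main (mainTime I.n I.edges.length I.demands.length) (fun σ' => ∃ f : ℕ → ℕ,
      HoldsOutput σ' (encodeEdges (I.edges.filter fun e => e ∈ I.flagSet f)) ∧
      ((∃ F, I.IsSolution F) → ∃ E : ℕ → Finset (Fin I.n × Fin I.n),
        (∀ (i : ℕ) (h : i < I.demands.length),
          I.IsMinEdgeSet I.demands[i].1.1 I.demands[i].1.2 I.demands[i].2 (E i)) ∧
        ∀ e, e ∈ I.flagSet f ↔ ∃ i < I.demands.length, e ∈ E i)) (inputMem I.encode) := by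
  have ha : inputMem I.encode 0 = I.input := rfl
  refine Wp.seq (T := (I.demands.length + 1) * (pairTime I.n I.edges.length + 100) + 3)
    (R := fun σ' => SameOff (6 :: 7 :: work) (inputMem I.encode) σ' ∧ ((∃ F, I.IsSolution F) →
      ∃ E : ℕ → Finset (Fin I.n × Fin I.n),
        (∀ (i : ℕ) (h : i < I.demands.length),
          I.IsMinEdgeSet I.demands[i].1.1 I.demands[i].1.2 I.demands[i].2 (E i)) ∧
        ∀ e, e ∈ I.flagSet (σ' 6) ↔ ∃ i < I.demands.length, e ∈ E i)) ?_ ?_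
  · refine (Wp.forLoop (T := pairTime I.n I.edges.length) (N := I.demands.length)
      (fun r σ' => SameOff (6 :: 7 :: work) (inputMem I.encode) σ' ∧ ((∃ F, I.IsSolution F) →
      ∃ E : ℕ → Finset (Fin I.n × Fin I.n),
        (∀ (i : ℕ) (h : i < I.demands.length), i < r →
          I.IsMinEdgeSet I.demands[i].1.1 I.demands[i].1.2 I.demands[i].2 (E i)) ∧
        ∀ e, e ∈ I.flagSet (σ' 6) ↔ ∃ i < r, e ∈ E i)) ?_ ?_ ?_ ?_).mono ?_ fun _ h => h
    · refine ⟨(SameOff.refl _ _).set (by decide) _ _, fun _ => ⟨fun _ => ∅, by simp, fun e => ?_⟩⟩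
      rw [Mem.set_ne _ _ (by decide), mem_flagSet_iff]
      simp [inputMem]
    · rintro r σ' ⟨h, -⟩
      simp [Expr.eval, h 0 (by decide), ha, input_numDemands]
    · rintro r σ' hr hc ⟨h1, h2⟩
      refine (wp_treatPair (by rw [h1 0 (by decide), ha]) hc hr).mono le_rfl ?_
      rintro σ'' ⟨g1, f, g2, g3⟩
      refine ⟨by rw [g1 7 (by decide), hc], (h1.trans (g1.trans (S' := 6 :: 7 :: work)
        (SameOff.refl _ _) (by decide)) (by decide)).set (by decide) _ _, fun hsol => ?_⟩
      obtain ⟨E, e1, e2⟩ := h2 hsol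
      obtain ⟨F, hF, hP⟩ := hsol
      refine ⟨Function.update E r (I.flagSet f), fun i hi hir => ?_, fun e => ?_⟩
      · rcases Nat.lt_succ_iff_lt_or_eq.1 hir with h | rfl
        · rw [Function.update_of_ne h.ne]; exact e1 i hi h
        · rw [Function.update_self]
          -- A solution shows that each single demand is feasible in the full edge set.
          exact g3 ((hP _ (List.getElem_mem hi)).mono hF)
      · rw [Mem.set_ne _ _ (by decide)]
        have hor : e ∈ I.flagSet (σ'' 6) ↔ e ∈ I.flagSet (σ' 6) ∨ e ∈ I.flagSet f := by
          simp only [mem_flagSet_iff, ← exists_or, ← and_or_left]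
          refine exists_congr fun j => exists_congr fun hj => ?_
          rw [g2 j hj]
          refine and_congr_right fun _ => ?_
          omega
        rw [hor, e2]
        constructor
        · rintro (⟨i, hi, h⟩ | h)
          · exact ⟨i, by omega, by rwa [Function.update_of_ne hi.ne]⟩
          · exact ⟨r, by omega, by rwa [Function.update_self]⟩
        · rintro ⟨i, hi, h⟩
          rcases Nat.lt_succ_iff_lt_or_eq.1 hi with h' | rfl
          · exact .inl ⟨i, h', by rwa [Function.update_of_ne h'.ne] at h⟩
          · exact .inr (by rwa [Function.update_self] at h)
    · rintro σ' ⟨h1, h2⟩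
      refine ⟨h1, fun hsol => ?_⟩
      obtain ⟨E, e1, e2⟩ := h2 hsol
      exact ⟨E, fun i hi => e1 i hi hi, e2⟩
    · simp only [Expr.cost]
      exact Nat.add_le_add_right (Nat.mul_le_mul_left _ (by omega)) _
  · rintro σ' ⟨h1, h2⟩
    refine (wp_emit (by rw [h1 0 (by decide), ha]) (by rw [h1 1 (by decide)]; rfl)).mono le_rfl ?_
    exact fun σ'' h => ⟨σ' 6, h, h2⟩

/-! ### The polynomial time bound. -/

theorem phaseTime_mono {n n' m m' : ℕ} (hn : n ≤ n') (hm : m ≤ m') :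
    phaseTime n m ≤ phaseTime n' m' := by
  unfold phaseTime; gcongr

theorem pairTime_mono {n n' m m' : ℕ} (hn : n ≤ n') (hm : m ≤ m') :
    pairTime n m ≤ pairTime n' m' := by
  have := phaseTime_mono hn hm
  unfold pairTime; gcongr

theorem mainTime_mono {n n' m m' k k' : ℕ} (hn : n ≤ n') (hm : m ≤ m') (hk : k ≤ k') :
    mainTime n m k ≤ mainTime n' m' k' := by
  have := pairTime_mono hn hm
  unfold mainTime; gcongr

theorem exists_polynomial_mainTime : ∃ P : Polynomial ℕ, ∀ S, P.eval S = mainTime S S S := by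
  let X : Polynomial ℕ := Polynomial.X
  let phase : Polynomial ℕ := (X + 1) * ((X + 1) * 220 + 20) + 3 + 100 + ((X + 1) * 20 + 3) +
    ((1 + X * X + 1) * 200 + (X + 1) * 40 + 200)
  let pair : Polynomial ℕ := (X + 1) * 20 + (X + 1) * 20 + 100 + (2 * X + 2) * (phase + 120) +
    (X + 1) * 50
  refine ⟨(X + 1) * (pair + 100) + 3 + ((X + 1) * 100 + 3), fun S => ?_⟩
  simp [X, phase, pair, mainTime, pairTime, phaseTime]

/-- The summand `1` per terminal pair suffices; the digits of the demands are not needed, since the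
time bound does not involve the demands. -/
theorem length_demands_le_size (I : DSNInstance) :
    I.demands.length ≤ (I.demands.map fun q => 1 + Nat.size q.2).sum := by
  induction I.demands with
  | nil => simp
  | cons q L ih => simp only [List.length_cons, List.map_cons, List.sum_cons]; omega

end DSNProgram

/-- There is an algorithm for Directed Steiner Network that halts on every instance within a number
of steps polynomial in the input size and that, on every instance with a solution, outputs (a
listing without repetitions of) a solution with at most `OPT ^ 2 * OPT` edges, namely a union of
minimum edge sets carrying the demands of the single terminal pairs. -/
theorem mainTheorem6 :
    ∃ (A : RAM.Prog) (P : Polynomial ℕ), ∀ I : DSNInstance,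
      ∃ (y : List ℕ) (t : ℕ), RAM.Outputs A I.encode y t ∧ t ≤ P.eval I.size ∧
        ((∃ F, I.IsSolution F) →
          ∃ L : List (Fin I.n × Fin I.n), y = DSNInstance.encodeEdges L ∧ L.Nodup ∧
            I.IsSolution L.toFinset ∧
            L.toFinset.card ≤ I.opt ^ 2 * I.opt ∧
            ∃ E : (Fin I.n × Fin I.n) × ℕ → Finset (Fin I.n × Fin I.n),
              (∀ q ∈ I.demands, I.IsMinEdgeSet q.1.1 q.1.2 q.2 (E q)) ∧
              L.toFinset = I.demands.toFinset.biUnion E) := by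
  obtain ⟨P, hP⟩ := DSNProgram.exists_polynomial_mainTime
  refine ⟨DSNProgram.main, P, fun I => ?_⟩
  obtain ⟨σ, t, hr, ht, f, hout, hsol⟩ := DSNProgram.wp_main I
  refine ⟨_, t, ⟨σ, hr, hout⟩, ?_, fun hex => ?_⟩
  · have := DSNProgram.length_demands_le_size I
    rw [hP]
    refine ht.trans (DSNProgram.mainTime_mono ?_ ?_ ?_) <;> unfold DSNInstance.size <;> omega
  · obtain ⟨E, hE, hmem⟩ := hsol hex
    -- Distinct entries let the family indexed by positions be reindexed by the entries themselves.
    have hnd : I.demands.Nodup := List.Nodup.of_map _ I.terminals_nodup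
    set E' : (Fin I.n × Fin I.n) × ℕ → Finset (Fin I.n × Fin I.n) :=
      fun q => E (I.demands.idxOf q) with hE'
    have hmin : ∀ q ∈ I.demands, I.IsMinEdgeSet q.1.1 q.1.2 q.2 (E' q) := by
      intro q hq
      obtain ⟨i, hi, rfl⟩ := List.getElem_of_mem hq
      rw [hE']
      simp only [hnd.idxOf_getElem]
      exact hE i hi
    have hunion : (I.edges.filter fun e => e ∈ I.flagSet f).toFinset =
        I.demands.toFinset.biUnion E' := by
      ext e
      have h1 : e ∈ (I.edges.filter fun e => e ∈ I.flagSet f).toFinset ↔ e ∈ I.flagSet f := by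
        simp only [List.mem_toFinset, List.mem_filter, decide_eq_true_eq, and_iff_right_iff_imp]
        exact fun h => List.mem_toFinset.1 (I.flagSet_subset f h)
      rw [h1, hmem, Finset.mem_biUnion]
      constructor
      · rintro ⟨i, hi, h⟩
        refine ⟨I.demands[i], List.mem_toFinset.2 (List.getElem_mem hi), ?_⟩
        simpa only [hE', hnd.idxOf_getElem] using h
      · rintro ⟨q, hq, h⟩
        exact ⟨_, List.idxOf_lt_length_of_mem (List.mem_toFinset.1 hq), h⟩
    refine ⟨_, rfl, I.edges_nodup.filter _, ⟨?_, fun q hq => ?_⟩, ?_, E', hmin, hunion⟩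
    · intro e he
      exact List.mem_toFinset.2 (List.mem_filter.1 (List.mem_toFinset.1 he)).1
    · rw [hunion]
      exact (hmin q hq).2.1.mono (Finset.subset_biUnion_of_mem E' (List.mem_toFinset.2 hq))
    · rw [hunion]
      exact I.card_biUnion_le hex E' hmin
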